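/- Let $\Omega$ be the complex plane minus the two cuts along the imaginary axis from $i/2$ to $i\infty$ and from $-i/2$ to $-i\infty$, and let $\vartheta$ be the Riemann–Siegel theta function, i.e. the holomorphic function on $\Omega$ with $\vartheta(0)=0$ and $$e^{2i\vartheta(z)}=\pi^{-iz}\,\frac{\Gamma(\frac14+\frac{iz}{2})}{\Gamma(\frac14-\frac{iz}{2})}\qquad(z\in\Omega).$$ For $t\in\mathbf R$ and any choice of $0<\sigma<\frac12$ (which by Cauchy's theorem is immaterial) put $$U(t)=\frac{1}{2\pi i}\int_{-i\sigma-\infty}^{-i\sigma+\infty}e^{i\vartheta(t+x)-i\vartheta(t)}\,\zeta\bigl(\tfrac12+i(t+x)\bigr)\frac{\pi}{2\sinh\frac{\pi x}{2}}\,dx .$$ This integral converges absolutely, and the following holds. Let $0<\varepsilon<1$ and $0<\sigma_0<2$. Then there is $C_0>0$, depending only on $\varepsilon$ and $\sigma_0$, such that for every $C\ge C_0$, with $b=C\log t$, we have as $t\to+\infty$ $$U(t)=\frac{1}{2\pi i}\int_{-b-i\sigma_0}^{b-i\sigma_0}e^{ix\vartheta'(t)+i\frac{x^2}{2}\vartheta''(t)}\,\zeta\bigl(\tfrac12+i(t+x)\bigr)\frac{\pi}{2\sinh\frac{\pi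 x}{2}}\,dx+O\bigl(t^{-\frac74+\varepsilon}\bigr),$$ where the implied constant may depend on $\varepsilon$, $\sigma_0$ and $C$. -/

import Mathlib

namespace RiemannSiegel

open Complex MeasureTheory Set

/-- The plane minus the two cuts along the imaginary axis, from `i/2` to `i∞` and from `-i/2`
to `-i∞`. -/
def cutPlane : Set ℂ := {z | z.re ≠ 0 ∨ |z.im| < 1 / 2}

/-- The derivative of the Riemann-Siegel theta function: half of the logarithmic derivative of
`π^(-iz) Γ(1/4 + iz/2) / Γ(1/4 - iz/2)`, divided by `i`. -/
noncomputable def thetaDensity (z : ℂ) : ℂ :=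
  (digamma (1 / 4 + I * z / 2) + digamma (1 / 4 - I * z / 2)) / 4 - Real.log Real.pi / 2

/-- The Riemann-Siegel theta function `ϑ` on `cutPlane`, as the integral of its derivative along
the segment from `0` to `z`. It is the holomorphic function on `cutPlane` with `ϑ 0 = 0` and
`exp (2 i ϑ z) = π^(-iz) Γ(1/4 + iz/2) / Γ(1/4 - iz/2)`: see `theta_zero`, `hasDerivAt_theta` and
`exp_theta` below. -/
noncomputable def theta (z : ℂ) : ℂ := z * ∫ s in (0 : ℝ)..1, thetaDensity (s * z)

/-- The kernel `ζ(1/2 + i(t+x)) * π / (2 sinh (π x / 2))`. -/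
noncomputable def kernel (t : ℝ) (x : ℂ) : ℂ :=
  riemannZeta (1 / 2 + I * (t + x)) * (Real.pi / (2 * sinh (Real.pi * x / 2)))

/-- The integrand defining `U(t)`. -/
noncomputable def integrandU (t : ℝ) (x : ℂ) : ℂ :=
  exp (I * theta (t + x) - I * theta t) * kernel t x

/-- `U(t)`, the integral along the horizontal line `Im x = -σ` (for `0 < σ < 1/2`). -/
noncomputable def U (σ t : ℝ) : ℂ :=
  1 / (2 * Real.pi * I) * ∫ y : ℝ, integrandU t (y - I * σ)

/-- The integrand of the second order approximation, with the phase
`x ϑ'(t) + (x²/2) ϑ''(t)`. -/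
noncomputable def integrandTaylor (t : ℝ) (x : ℂ) : ℂ :=
  exp (I * x * deriv theta t + I * (x ^ 2 / 2) * deriv (deriv theta) t) * kernel t x

/-- The integral of `integrandTaylor` along the segment from `-b - iσ₀` to `b - iσ₀`. -/
noncomputable def taylorApprox (σ₀ b t : ℝ) : ℂ :=
  1 / (2 * Real.pi * I) * ∫ y in (-b)..b, integrandTaylor t (y - I * σ₀)

theorem isOpen_cutPlane : IsOpen cutPlane := by
  have h1 : IsOpen {z : ℂ | z.re ≠ 0} := isOpen_ne_fun continuous_re continuous_const
  have h2 : IsOpen {z : ℂ | |z.im| < 1 / 2} := isOpen_lt continuous_im.abs continuous_const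
  exact h1.union h2

theorem smul_mem_cutPlane {z : ℂ} (hz : z ∈ cutPlane) {s : ℝ} (h0 : 0 ≤ s) (h1 : s ≤ 1) :
    (s : ℂ) * z ∈ cutPlane := by
  simp only [cutPlane, mem_ofPred_eq, re_ofReal_mul, im_ofReal_mul, abs_mul, abs_of_nonneg h0] at *
  rcases h0.eq_or_lt with rfl | h0'
  · right; norm_num
  rcases hz with hz | hz
  · left; exact mul_ne_zero h0'.ne' hz
  · right; nlinarith [abs_nonneg z.im]

theorem zero_mem_cutPlane : (0 : ℂ) ∈ cutPlane := by simp [cutPlane]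

theorem add_ne_neg_nat {z : ℂ} (hz : z ∈ cutPlane) (m : ℕ) : 1 / 4 + I * z / 2 ≠ -m := by
  intro h
  have h1 := congrArg re h
  have h2 := congrArg im h
  have e1 : (1 / 4 + I * z / 2).re = 1 / 4 - z.im / 2 := by
    have : (1 / 4 + I * z / 2 : ℂ) = ((1 / 4 - z.im / 2 : ℝ) : ℂ) + (z.re / 2 : ℝ) * I := by
      apply Complex.ext
      · simp; ring
      · simp
    rw [this]; simp
  have e2 : (1 / 4 + I * z / 2).im = z.re / 2 := by
    have : (1 / 4 + I * z / 2 : ℂ) = ((1 / 4 - z.im / 2 : ℝ) : ℂ) + (z.re / 2 : ℝ) * I := by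
      apply Complex.ext
      · simp; ring
      · simp
    rw [this]; simp
  rw [e1] at h1
  rw [e2] at h2
  simp only [neg_re, natCast_re, neg_im, natCast_im, neg_zero] at h1 h2
  have hm : (0 : ℝ) ≤ m := m.cast_nonneg
  rcases hz with hz | hz
  · exact hz (by linarith)
  · have := abs_lt.1 hz
    linarith

theorem neg_mem_cutPlane {z : ℂ} (hz : z ∈ cutPlane) : -z ∈ cutPlane := by
  simpa [cutPlane] using hz

theorem sub_ne_neg_nat {z : ℂ} (hz : z ∈ cutPlane) (m : ℕ) : 1 / 4 - I * z / 2 ≠ -m := by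
  have := add_ne_neg_nat (neg_mem_cutPlane hz) m
  rwa [show (1 / 4 - I * z / 2 : ℂ) = 1 / 4 + I * (-z) / 2 by ring]

theorem isOpen_compl_neg_nat : IsOpen {s : ℂ | ∀ m : ℕ, s ≠ -m} := by
  have h' : IsClosed ((fun n : ℤ => (n : ℂ)) '' Iic 0) :=
    Complex.isClosedEmbedding_intCast.isClosedMap _ (isClosed_discrete _)
  convert h'.isOpen_compl using 1
  ext s
  simp only [mem_ofPred_eq, mem_compl_iff, mem_image, mem_Iic, not_exists, not_and]
  constructor
  · intro hs n hn he
    refine hs n.natAbs ?_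
    rw [← he]
    have : (n : ℤ) = -(n.natAbs : ℤ) := by omega
    calc (n : ℂ) = ((-(n.natAbs : ℤ) : ℤ) : ℂ) := by rw [← this]
      _ = _ := by rw [Int.cast_neg, Int.cast_natCast]
  · intro hs m hm
    exact hs (-(m : ℤ)) (by omega) (by rw [hm]; push_cast; rfl)

theorem differentiableAt_digamma {s : ℂ} (hs : ∀ m : ℕ, s ≠ -m) :
    DifferentiableAt ℂ digamma s := by
  have hG : DifferentiableOn ℂ Gamma {s : ℂ | ∀ m : ℕ, s ≠ -m} := fun x hx =>
    (differentiableAt_Gamma x hx).differentiableWithinAt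
  have hd := (hG.deriv isOpen_compl_neg_nat).differentiableAt
    (isOpen_compl_neg_nat.mem_nhds hs)
  exact hd.div (differentiableAt_Gamma s hs) (Gamma_ne_zero hs)

theorem differentiableOn_thetaDensity : DifferentiableOn ℂ thetaDensity cutPlane := by
  intro z hz
  have h1 : DifferentiableAt ℂ (fun z : ℂ => digamma (1 / 4 + I * z / 2)) z :=
    (differentiableAt_digamma (add_ne_neg_nat hz)).comp z (by fun_prop)
  have h2 : DifferentiableAt ℂ (fun z : ℂ => digamma (1 / 4 - I * z / 2)) z :=
    (differentiableAt_digamma (sub_ne_neg_nat hz)).comp z (by fun_prop)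
  exact (((h1.add h2).div_const 4).sub_const _).differentiableWithinAt

theorem theta_zero : theta 0 = 0 := by simp [theta]

theorem hasDerivAt_theta {z : ℂ} (hz : z ∈ cutPlane) :
    HasDerivAt theta (thetaDensity z) z := by
  have hg := differentiableOn_thetaDensity
  have hgc : ContinuousOn thetaDensity cutPlane := hg.continuousOn
  have hg'c : ContinuousOn (deriv thetaDensity) cutPlane :=
    (hg.deriv isOpen_cutPlane).continuousOn
  obtain ⟨r, hr, hball⟩ := Metric.nhds_basis_closedBall.mem_iff.1 (isOpen_cutPlane.mem_nhds hz)
  have huIoc : ∀ s ∈ uIoc (0 : ℝ) 1, s ∈ Icc (0 : ℝ) 1 := by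
    intro s hs
    rw [uIoc_of_le zero_le_one] at hs
    exact ⟨hs.1.le, hs.2⟩
  have hcont : ∀ w ∈ cutPlane, ∀ f : ℂ → ℂ, ContinuousOn f cutPlane →
      ContinuousOn (fun s : ℝ => f (s * w)) (Icc 0 1) := by
    intro w hw f hf
    exact hf.comp (by fun_prop) (fun s hs => smul_mem_cutPlane hw hs.1 hs.2)
  have hK : IsCompact (Icc (0 : ℝ) 1 ×ˢ Metric.closedBall z r) :=
    isCompact_Icc.prod (isCompact_closedBall z r)
  have hFc : ContinuousOn (fun p : ℝ × ℂ => (p.1 : ℂ) * deriv thetaDensity (p.1 * p.2))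
      (Icc (0 : ℝ) 1 ×ˢ Metric.closedBall z r) := by
    refine ContinuousOn.mul (by fun_prop) ?_
    exact hg'c.comp (by fun_prop) (fun p hp => smul_mem_cutPlane (hball hp.2) hp.1.1 hp.1.2)
  obtain ⟨M, hM⟩ := hK.exists_bound_of_continuousOn hFc
  have hmeas : ∀ f : ℝ → ℂ, ContinuousOn f (Icc 0 1) →
      AEStronglyMeasurable f (volume.restrict (uIoc 0 1)) := by
    intro f hf
    rw [uIoc_of_le zero_le_one]
    exact (hf.mono Ioc_subset_Icc_self).aestronglyMeasurable measurableSet_Ioc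
  have hint : IntervalIntegrable (fun s : ℝ => thetaDensity (s * z)) volume 0 1 := by
    apply ContinuousOn.intervalIntegrable
    rw [uIcc_of_le zero_le_one]
    exact hcont z hz _ hgc
  have key := intervalIntegral.hasDerivAt_integral_of_dominated_loc_of_deriv_le
    (μ := volume) (a := (0 : ℝ)) (b := 1) (x₀ := z)
    (F := fun w s => thetaDensity (s * w)) (F' := fun w s => s * deriv thetaDensity (s * w))
    (s := Metric.closedBall z r) (bound := fun _ => M)
    (Metric.closedBall_mem_nhds z hr)
    (by
      filter_upwards [Metric.closedBall_mem_nhds z hr] with w hw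
      exact hmeas _ (hcont w (hball hw) _ hgc))
    hint
    (hmeas _ (ContinuousOn.mul (by fun_prop) (hcont z hz _ hg'c)))
    (Filter.Eventually.of_forall fun s hs w hw => hM (s, w) ⟨huIoc s hs, hw⟩)
    intervalIntegrable_const
    (Filter.Eventually.of_forall fun s hs w hw => by
      have hs' := huIoc s hs
      have hd := (hg.differentiableAt (isOpen_cutPlane.mem_nhds
        (smul_mem_cutPlane (hball hw) hs'.1 hs'.2))).hasDerivAt
      have hl : HasDerivAt (fun w : ℂ => (s : ℂ) * w) s w := by
        simpa using (hasDerivAt_id w).const_mul (s : ℂ)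
      have hc := hd.comp w hl
      rw [mul_comm] at hc
      exact hc)
  have hprod := (hasDerivAt_id z).mul key.2
  have hval : thetaDensity z = 1 * (∫ s in (0 : ℝ)..1, thetaDensity (s * z)) +
      z * ∫ s in (0 : ℝ)..1, (s : ℂ) * deriv thetaDensity (s * z) := by
    have hftc : ∫ s in (0 : ℝ)..1,
        (thetaDensity (s * z) + z * ((s : ℂ) * deriv thetaDensity (s * z))) =
        ((1 : ℝ) : ℂ) * thetaDensity ((1 : ℝ) * z) - ((0 : ℝ) : ℂ) * thetaDensity ((0 : ℝ) * z) := by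
      apply intervalIntegral.integral_eq_sub_of_hasDerivAt
        (f := fun s : ℝ => (s : ℂ) * thetaDensity (s * z))
      · intro s hs
        rw [uIcc_of_le zero_le_one] at hs
        have hd := (hg.differentiableAt (isOpen_cutPlane.mem_nhds
          (smul_mem_cutPlane hz hs.1 hs.2))).hasDerivAt
        have hl : HasDerivAt (fun w : ℂ => w * z) z (s : ℂ) := by
          simpa using (hasDerivAt_id (s : ℂ)).mul_const z
        have hc := (hasDerivAt_id (s : ℂ)).mul (hd.comp (s : ℂ) hl)
        refine hc.comp_ofReal.congr_deriv ?_
        change 1 * thetaDensity (s * z) + (s : ℂ) * (deriv thetaDensity (s * z) * z) = _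
        ring
      · exact hint.add (key.1.const_mul z)
    rw [intervalIntegral.integral_add hint (key.1.const_mul z),
      intervalIntegral.integral_const_mul] at hftc
    simpa using hftc.symm
  rw [hval]
  exact hprod

theorem exp_theta {z : ℂ} (hz : z ∈ cutPlane) :
    exp (2 * I * theta z) =
      (Real.pi : ℂ) ^ (-I * z) * Gamma (1 / 4 + I * z / 2) / Gamma (1 / 4 - I * z / 2) := by
  have hpi : (Real.pi : ℂ) ≠ 0 := by exact_mod_cast Real.pi_ne_zero
  set H : ℂ → ℂ := fun w => exp (2 * I * theta w + I * w * Real.log Real.pi) *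
    (Gamma (1 / 4 - I * w / 2) / Gamma (1 / 4 + I * w / 2)) with hH
  have hder : ∀ w ∈ cutPlane, HasDerivAt H 0 w := by
    intro w hw
    have hp := add_ne_neg_nat hw
    have hm := sub_ne_neg_nat hw
    have lp : HasDerivAt (fun w : ℂ => 1 / 4 + I * w / 2) (I / 2) w := by
      simpa using (((hasDerivAt_id w).const_mul I).div_const 2).const_add (1 / 4 : ℂ)
    have lm : HasDerivAt (fun w : ℂ => 1 / 4 - I * w / 2) (-(I / 2)) w := by
      simpa using (((hasDerivAt_id w).const_mul I).div_const 2).const_sub (1 / 4 : ℂ)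
    have gp := (differentiableAt_Gamma _ hp).hasDerivAt.comp w lp
    have gm := (differentiableAt_Gamma _ hm).hasDerivAt.comp w lm
    have he := (((hasDerivAt_theta hw).const_mul (2 * I)).add
      (((hasDerivAt_id w).const_mul I).mul_const (Real.log Real.pi : ℂ))).cexp
    have hall := he.mul (gm.div gp (Gamma_ne_zero hp))
    refine hall.congr_deriv ?_
    have hp0 := Gamma_ne_zero hp
    have hm0 := Gamma_ne_zero hm
    simp only [thetaDensity, digamma_def, logDeriv_apply]
    change cexp (2 * I * theta w + I * w * Real.log Real.pi) * _ *
      (Gamma (1 / 4 - I * w / 2) / Gamma (1 / 4 + I * w / 2)) +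
      cexp (2 * I * theta w + I * w * Real.log Real.pi) *
      ((_ * Gamma (1 / 4 + I * w / 2) - Gamma (1 / 4 - I * w / 2) * _) /
        Gamma (1 / 4 + I * w / 2) ^ 2) = 0
    generalize cexp (2 * I * theta w + I * w * Real.log Real.pi) = E at *
    generalize deriv Gamma (1 / 4 + I * w / 2) = dp at *
    generalize deriv Gamma (1 / 4 - I * w / 2) = dm at *
    generalize Gamma (1 / 4 + I * w / 2) = a at *
    generalize Gamma (1 / 4 - I * w / 2) = b at *
    field_simp
    ring
  have hpre : IsPreconnected cutPlane := by
    have : StarConvex ℝ 0 cutPlane := by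
      rw [starConvex_zero_iff]
      intro x hx a h0 h1
      simpa using smul_mem_cutPlane hx h0 h1
    exact (this.isPathConnected zero_mem_cutPlane).isConnected.isPreconnected
  have hconst : H z = H 0 :=
    isOpen_cutPlane.is_const_of_deriv_eq_zero hpre
      (fun w hw => (hder w hw).differentiableAt.differentiableWithinAt)
      (fun w hw => (hder w hw).deriv) hz zero_mem_cutPlane
  have hp0 := Gamma_ne_zero (add_ne_neg_nat hz)
  have hm0 := Gamma_ne_zero (sub_ne_neg_nat hz)
  have hH0 : H 0 = 1 := by
    have := Gamma_ne_zero (add_ne_neg_nat zero_mem_cutPlane)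
    simp only [hH, theta_zero, mul_zero, zero_mul, add_zero, exp_zero, zero_div, sub_zero, one_mul]
      at this ⊢
    exact div_self this
  rw [hH0] at hconst
  simp only [hH, exp_add] at hconst
  have hcpow : (Real.pi : ℂ) ^ (-I * z) = (exp (I * z * Real.log Real.pi))⁻¹ := by
    rw [cpow_def_of_ne_zero hpi, ← exp_neg, ofReal_log Real.pi_nonneg]
    congr 1
    ring
  have hE := exp_ne_zero (I * z * Real.log Real.pi)
  rw [hcpow]
  generalize Gamma (1 / 4 + I * z / 2) = a at *
  generalize Gamma (1 / 4 - I * z / 2) = b at *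
  field_simp at hconst ⊢
  linear_combination hconst

end RiemannSiegel

/-! The exponent comes from a single line of integration, `Im x = -(1/2 + ε)`. There the zeta factor
has real part `1 + ε`, hence is bounded; since `ϑ'(t) = (log t)/2 + O(1)`, the factor `exp(i x
ϑ'(t))` has size `t^(1/4 + ε/2)`; and since `ϑ''' = O(t⁻²)` near `t`, replacing `ϑ(t+x) - ϑ(t)` by
its second order Taylor polynomial costs a relative error `O(b³ t⁻²)`. Integrating over a segment of
length `2b` gives `b⁴ t^(-7/4 + ε/2)`, and powers of `b = C log t` are absorbed in `t^(ε/2)`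
(`exists_norm_integrandU_sub_integrandTaylor_le`).

Reaching this line costs only negligible terms. On `Im x = -σ` both `exp(iϑ)` and `ζ` grow at most
linearly while `1/sinh` decays exponentially, so the tails `|y| > b` contribute `O(t² e^(-b))`. Over
`|y| ≤ b < t` the strip `-2 < Im x < 0` contains no zero of the `sinh`, no pole of `ζ` and no point
of the cuts, so Cauchy's theorem moves the truncated segment; the vertical sides are again `O(t²
e^(-b))`. The same shift takes the Taylor integral to `Im x = -σ₀`.

The analytic inputs are crude. `norm_riemannZeta_le` gives linear growth of `ζ` from the fractional
part integral. `norm_digamma_sub_log_le` gives `ψ(s) = log s + O(1)` for `|Im s| ≥ 1`, in both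
half-planes, hence `ϑ'(z) = (log z)/2 + O(1)`; Cauchy's estimates on discs of radius `Re z / 2` then
bound `ϑ''` and `ϑ'''`. Moduli of `exp(iϑ)` are controlled because `ϑ` is real on the real axis. -/

namespace RiemannSiegel

open Complex MeasureTheory Set Filter Topology

/-! ### Bounds for the zeta function -/

/-- The truncation to `(1, ∞)` of the fractional part. -/
noncomputable def fractTail : ℝ → ℂ := indicator (Ioi 1) fun t => ((Int.fract t : ℝ) : ℂ)

theorem measurable_fractTail : Measurable fractTail :=
  (measurable_ofReal.comp measurable_fract).indicator measurableSet_Ioi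

theorem norm_fractTail_le (t : ℝ) : ‖fractTail t‖ ≤ 1 := by
  unfold fractTail indicator
  split_ifs
  · rw [norm_real, Real.norm_of_nonneg (Int.fract_nonneg t)]
    exact (Int.fract_lt_one t).le
  · simp

theorem locallyIntegrable_fractTail : LocallyIntegrable fractTail :=
  (locallyIntegrable_const (1 : ℝ)).mono measurable_fractTail.aestronglyMeasurable
    (Filter.Eventually.of_forall fun t => by simpa using norm_fractTail_le t)

/-- Writing the integral as a Mellin transform makes its holomorphy in `s` available from the
general theory. -/
theorem mellin_fractTail (s : ℂ) :
    mellin fractTail (-s) = ∫ t in Ioi (1 : ℝ), ((Int.fract t : ℝ) : ℂ) * (t : ℂ) ^ (-(s + 1)) := by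
  rw [mellin]
  have : ∀ t : ℝ, (t : ℂ) ^ (-s - 1) • fractTail t =
      indicator (Ioi 1) (fun t : ℝ => ((Int.fract t : ℝ) : ℂ) * (t : ℂ) ^ (-(s + 1))) t := by
    intro t
    unfold fractTail indicator
    split_ifs
    · rw [smul_eq_mul, mul_comm, neg_add, sub_eq_add_neg]
    · simp
  simp_rw [this]
  rw [setIntegral_indicator measurableSet_Ioi, inter_eq_right.2 (Ioi_subset_Ioi zero_le_one)]

theorem differentiableAt_mellin_fractTail {s : ℂ} (hs : 0 < s.re) :
    DifferentiableAt ℂ (fun s => mellin fractTail (-s)) s := by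
  have h : DifferentiableAt ℂ (mellin fractTail) (-s) := by
    -- Boundedness at infinity forces `Re(-s) < a = 0`. Near `0` the function vanishes, so any `b <
    -- Re(-s)` serves.
    refine mellin_differentiableAt_of_isBigO_rpow (a := 0) (b := -s.re - 1)
      (locallyIntegrable_fractTail.locallyIntegrableOn _) ?_ (by simpa) ?_ (by simp)
    · refine Asymptotics.IsBigO.of_bound 1 (Filter.Eventually.of_forall fun t => ?_)
      simpa using norm_fractTail_le t
    · refine Asymptotics.IsBigO.of_bound 1 ?_
      filter_upwards [mem_nhdsWithin_of_mem_nhds (Iio_mem_nhds (zero_lt_one' ℝ))] with t ht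
      have : fractTail t = 0 := indicator_of_notMem (by simpa using le_of_lt ht) _
      rw [this, norm_zero]
      positivity
  exact h.comp s differentiableAt_id.neg

theorem integrableOn_fract_mul_cpow {s : ℂ} (hs : 0 < s.re) :
    IntegrableOn (fun t : ℝ => ((Int.fract t : ℝ) : ℂ) * (t : ℂ) ^ (-(s + 1))) (Ioi 1) := by
  refine (integrableOn_Ioi_cpow_of_lt (a := -(s + 1)) (by simp; linarith)
    one_pos).bdd_mul (c := 1) (measurable_ofReal.comp measurable_fract).aestronglyMeasurable ?_
  refine Filter.Eventually.of_forall fun t => ?_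
  rw [norm_real, Real.norm_of_nonneg (Int.fract_nonneg t)]
  exact (Int.fract_lt_one t).le

theorem norm_mellin_fractTail_le {s : ℂ} (hs : 0 < s.re) :
    ‖mellin fractTail (-s)‖ ≤ 1 / s.re := by
  rw [mellin_fractTail]
  have hI : ∫ t in Ioi (1 : ℝ), t ^ (-(s.re + 1)) = 1 / s.re := by
    rw [integral_Ioi_rpow_of_lt (by linarith) one_pos]
    simp [neg_div_neg_eq]
  rw [← hI]
  refine norm_integral_le_of_norm_le (integrableOn_Ioi_rpow_of_lt (by linarith) one_pos) ?_
  refine (ae_restrict_iff' measurableSet_Ioi).2 (Filter.Eventually.of_forall fun t ht => ?_)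
  have ht0 : (0 : ℝ) < t := one_pos.trans ht
  rw [norm_mul, norm_cpow_eq_rpow_re_of_pos ht0, norm_real,
    Real.norm_of_nonneg (Int.fract_nonneg t)]
  simpa using mul_le_of_le_one_left (Real.rpow_nonneg ht0.le _) (Int.fract_lt_one t).le

/-- Abel summation gives `ζ(s) = s ∫ ⌊t⌋ t^(-s-1) dt` over `t > 1`; substitute `⌊t⌋ = t - {t}`. -/
theorem riemannZeta_eq_sub_mellin_of_one_lt {s : ℂ} (hs : 1 < s.re) :
    riemannZeta s = s / (s - 1) - s * mellin fractTail (-s) := by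
  have hs1 : s - 1 ≠ 0 := by
    intro h
    have := congrArg re h
    simp at this
    linarith
  have hL := LSeries_eq_mul_integral_of_nonneg (fun _ => 1) (r := 1) zero_le_one hs
    (by simpa using Asymptotics.isBigO_refl _ _) (by simp)
  have h1 : LSeries (fun _ => ((1 : ℝ) : ℂ)) s = riemannZeta s := by
    rw [← LSeries_one_eq_riemannZeta hs]
    simp only [ofReal_one]
    rfl
  rw [h1] at hL
  have hI : ∫ t in Ioi (1 : ℝ), (t : ℂ) ^ (-s) = 1 / (s - 1) := by
    rw [integral_Ioi_cpow_of_lt (by simpa) one_pos]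
    rw [ofReal_one, one_cpow, show -s + 1 = -(s - 1) by ring, neg_div_neg_eq]
  rw [hL, mellin_fractTail, div_eq_mul_one_div, ← hI, ← mul_sub,
    ← integral_sub (integrableOn_Ioi_cpow_of_lt (by simpa) one_pos)
      (integrableOn_fract_mul_cpow (by linarith))]
  congr 1
  refine setIntegral_congr_fun measurableSet_Ioi fun t ht => ?_
  have ht0 : (0 : ℝ) < t := one_pos.trans ht
  have hfl : ((⌊t⌋₊ : ℕ) : ℂ) = t - ((Int.fract t : ℝ) : ℂ) := by
    rw [Int.fract, ofReal_sub, sub_sub_cancel]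
    rw [← Int.natCast_floor_eq_floor ht0.le]
    simp
  have hc : (t : ℂ) ^ (-s) = t * (t : ℂ) ^ (-(s + 1)) := by
    rw [show -s = 1 + -(s + 1) by ring, cpow_add _ _ (ofReal_ne_zero.2 ht0.ne'), cpow_one]
  simp only [ofReal_one, Finset.sum_const, Nat.card_Icc, add_tsub_cancel_right, nsmul_eq_mul,
    mul_one]
  rw [hfl, hc]
  ring

/-- Analytic continuation from `Re s > 1`. Multiplying by `s - 1` removes the pole, so the identity
theorem applies on the whole half-plane, which is connected, to `riemannZeta₁`. -/
theorem riemannZeta_eq_sub_mellin {s : ℂ} (hs : 0 < s.re) (hs1 : s ≠ 1) :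
    riemannZeta s = s / (s - 1) - s * mellin fractTail (-s) := by
  have hU : IsOpen {s : ℂ | 0 < s.re} := isOpen_lt continuous_const continuous_re
  have hpre : IsPreconnected {s : ℂ | 0 < s.re} := (convex_halfSpace_re_gt 0).isPreconnected
  have hf : AnalyticOnNhd ℂ riemannZeta₁ {s : ℂ | 0 < s.re} :=
    differentiable_riemannZeta₁.differentiableOn.analyticOnNhd hU
  have hg : AnalyticOnNhd ℂ (fun s => s - (s - 1) * s * mellin fractTail (-s))
      {s : ℂ | 0 < s.re} := by
    refine DifferentiableOn.analyticOnNhd (fun s hs => ?_) hU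
    exact (differentiableAt_id.sub (((differentiableAt_id.sub_const 1).mul differentiableAt_id).mul
      (differentiableAt_mellin_fractTail hs))).differentiableWithinAt
  have hev : riemannZeta₁ =ᶠ[nhds 2] fun s => s - (s - 1) * s * mellin fractTail (-s) := by
    filter_upwards [(isOpen_lt continuous_const continuous_re).mem_nhds
      (show (1 : ℝ) < (2 : ℂ).re by simp)] with w hw
    have hw1 : w ≠ 1 := by rintro rfl; simp at hw
    have h := riemannZeta_eq_inv_sub_mul hw1
    rw [riemannZeta_eq_sub_mellin_of_one_lt hw] at h
    have := sub_ne_zero.2 hw1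
    field_simp at h
    linear_combination -h
  have := hf.eqOn_of_preconnected_of_eventuallyEq hg hpre (by simp) hev hs
  rw [riemannZeta_eq_inv_sub_mul hs1, this]
  have := sub_ne_zero.2 hs1
  field_simp

theorem norm_riemannZeta_le {s : ℂ} (hs : 0 < s.re) (hs1 : s ≠ 1) :
    ‖riemannZeta s‖ ≤ ‖s‖ / ‖s - 1‖ + ‖s‖ / s.re := by
  rw [riemannZeta_eq_sub_mellin hs hs1]
  refine (norm_sub_le _ _).trans ?_
  rw [norm_div, norm_mul, div_eq_mul_one_div _ s.re]
  gcongr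
  exact norm_mellin_fractTail_le hs

theorem exists_norm_riemannZeta_le {c : ℝ} (hc : 1 < c) :
    ∃ M, ∀ s : ℂ, c ≤ s.re → ‖riemannZeta s‖ ≤ M := by
  refine ⟨∑' n : ℕ, 1 / (n : ℝ) ^ c, fun s hs => ?_⟩
  rw [zeta_eq_tsum_one_div_nat_cpow (hc.trans_le hs)]
  refine tsum_of_norm_bounded (Real.summable_one_div_nat_rpow.2 hc).hasSum fun n => ?_
  rcases n.eq_zero_or_pos with rfl | hn
  · have : s ≠ 0 := by rintro rfl; simp at hs; linarith
    simp only [CharP.cast_eq_zero, one_div, zero_cpow this, inv_zero, norm_zero]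
    positivity
  · rw [norm_div, norm_one, norm_natCast_cpow_of_pos hn]
    have : (1 : ℝ) ≤ n := by exact_mod_cast hn
    gcongr

/-! ### The digamma function -/

/-- Cauchy's formula for the derivative on a small circle and dominated convergence: a uniform bound
and pointwise convergence suffice. -/
theorem tendsto_deriv_of_tendsto_of_norm_le {F : ℕ → ℂ → ℂ} {f : ℂ → ℂ} {U : Set ℂ} {M : ℝ}
    (hU : IsOpen U) (hF : ∀ᶠ n in atTop, DifferentiableOn ℂ (F n) U) (hf : DifferentiableOn ℂ f U)
    (hlim : ∀ z ∈ U, Tendsto (fun n => F n z) atTop (𝓝 (f z)))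
    (hM : ∀ᶠ n in atTop, ∀ z ∈ U, ‖F n z‖ ≤ M) {z : ℂ} (hz : z ∈ U) :
    Tendsto (fun n => deriv (F n) z) atTop (𝓝 (deriv f z)) := by
  obtain ⟨r, hr, hball⟩ := Metric.nhds_basis_closedBall.mem_iff.1 (hU.mem_nhds hz)
  have hcir : ∀ θ : ℝ, circleMap z r θ ∈ U := fun θ =>
    hball (circleMap_mem_closedBall z hr.le θ)
  have hsub : ∀ θ : ℝ, ‖circleMap z r θ - z‖ = r := fun θ => by
    simp [circleMap, abs_of_pos hr]
  have key := two_pi_I_inv_smul_circleIntegral_sub_sq_inv_smul_of_differentiable (w₀ := z) hU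
    hball hf (Metric.mem_ball_self hr)
  rw [← key]
  have hcongr : (fun n => (2 * (Real.pi : ℂ) * I)⁻¹ • ∮ w in C(z, r), ((w - z) ^ 2)⁻¹ • F n w)
      =ᶠ[atTop] fun n => deriv (F n) z := by
    filter_upwards [hF] with n hn
    exact two_pi_I_inv_smul_circleIntegral_sub_sq_inv_smul_of_differentiable hU hball hn
      (Metric.mem_ball_self hr)
  refine Tendsto.congr' hcongr (Tendsto.const_smul ?_ _)
  unfold circleIntegral
  refine intervalIntegral.tendsto_integral_filter_of_dominated_convergence
    (fun _ => r * ((r ^ 2)⁻¹ * M)) ?_ ?_ intervalIntegrable_const ?_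
  · filter_upwards [hF] with n hn
    refine Continuous.aestronglyMeasurable ?_
    have hc1 : Continuous fun θ => F n (circleMap z r θ) :=
      hn.continuousOn.comp_continuous (continuous_circleMap z r) hcir
    have hc2 : Continuous fun θ => ((circleMap z r θ - z) ^ 2)⁻¹ := by
      refine Continuous.inv₀ (by fun_prop) fun θ h => ?_
      have := hsub θ
      rw [pow_eq_zero_iff two_ne_zero] at h
      rw [h, norm_zero] at this
      exact hr.ne this
    simp only [deriv_circleMap]
    exact ((continuous_circleMap 0 r).mul continuous_const).smul (hc2.smul hc1)
  · filter_upwards [hM] with n hn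
    refine Eventually.of_forall fun θ _ => ?_
    rw [norm_smul, norm_smul, norm_inv, norm_pow, hsub, deriv_circleMap]
    simp only [norm_mul, norm_circleMap_zero, norm_I, mul_one, abs_of_pos hr]
    gcongr
    exact hn _ (hcir θ)
  · exact Eventually.of_forall fun θ _ => ((hlim _ (hcir θ)).const_smul _).const_smul _

/-- In Euler's integral `(1 - x/n)^n ≤ e^(-x)`, and `x^(Re s - 1) ≤ x^(a-1) + x^(b-1)` on either
side of `x = 1`. This is the uniform bound needed to differentiate Euler's limit. -/
theorem norm_GammaSeq_le {s : ℂ} {a b : ℝ} (ha : 0 < a) (hb : 0 < b) (has : a ≤ s.re)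
    (hsb : s.re ≤ b) {n : ℕ} (hn : n ≠ 0) :
    ‖GammaSeq s n‖ ≤ Real.Gamma a + Real.Gamma b := by
  have hs : 0 < s.re := ha.trans_le has
  rw [GammaSeq_eq_approx_Gamma_integral hs hn, Real.Gamma_eq_integral ha,
    Real.Gamma_eq_integral hb, ← integral_add (Real.GammaIntegral_convergent ha)
      (Real.GammaIntegral_convergent hb), intervalIntegral.integral_of_le n.cast_nonneg]
  have hint := (Real.GammaIntegral_convergent ha).add (Real.GammaIntegral_convergent hb)
  refine (norm_integral_le_of_norm_le (hint.mono_set Ioc_subset_Ioi_self) ?_).trans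
    (setIntegral_mono_set hint ?_ (LE.le.eventuallyLE Ioc_subset_Ioi_self))
  · refine (ae_restrict_iff' measurableSet_Ioc).2 (Eventually.of_forall fun x hx => ?_)
    have hx0 := hx.1
    have hn0 : (0 : ℝ) < n := by positivity
    have h1 : 0 ≤ 1 - x / n := by rw [sub_nonneg, div_le_one hn0]; exact hx.2
    rw [norm_mul, norm_cpow_eq_rpow_re_of_pos hx0, norm_real, Real.norm_of_nonneg (by positivity)]
    simp only [sub_re, one_re, Pi.add_apply]
    rw [← mul_add]
    refine mul_le_mul (Real.one_sub_div_pow_le_exp_neg hx.2) ?_ (by positivity) (by positivity)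
    rcases le_total 1 x with h | h
    · have := Real.rpow_le_rpow_of_exponent_le h (show s.re - 1 ≤ b - 1 by linarith)
      have := Real.rpow_nonneg hx0.le (a - 1)
      linarith
    · have := Real.rpow_le_rpow_of_exponent_ge hx0 h (show a - 1 ≤ s.re - 1 by linarith)
      have := Real.rpow_nonneg hx0.le (b - 1)
      linarith
  · refine (ae_restrict_iff' measurableSet_Ioi).2 (Eventually.of_forall fun x hx => ?_)
    have hx0 : 0 < x := hx
    simp only [Pi.add_apply, Pi.zero_apply]
    positivity

/-- The logarithmic derivative of `Complex.GammaSeq`. -/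
noncomputable def digammaSeq (s : ℂ) (n : ℕ) : ℂ :=
  Real.log n - ∑ k ∈ Finset.range (n + 1), (s + k)⁻¹

theorem add_natCast_ne_zero_of_re_pos {s : ℂ} (hs : 0 < s.re) (k : ℕ) : s + k ≠ 0 := by
  intro h
  have := congrArg re h
  simp at this
  linarith [(k.cast_nonneg : (0 : ℝ) ≤ k)]

theorem differentiableAt_GammaSeq {s : ℂ} (hs : 0 < s.re) {n : ℕ} (hn : n ≠ 0) :
    DifferentiableAt ℂ (fun s => GammaSeq s n) s := by
  unfold GammaSeq
  refine DifferentiableAt.div ?_ (by fun_prop)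
    (Finset.prod_ne_zero_iff.2 fun k _ => add_natCast_ne_zero_of_re_pos hs k)
  exact (differentiableAt_id.const_cpow (Or.inl (Nat.cast_ne_zero.2 hn))).mul_const _

theorem logDeriv_GammaSeq {s : ℂ} (hs : 0 < s.re) {n : ℕ} (hn : n ≠ 0) :
    logDeriv (fun s => GammaSeq s n) s = digammaSeq s n := by
  have hn' : (n : ℂ) ≠ 0 := Nat.cast_ne_zero.2 hn
  have h1 : HasDerivAt (fun s : ℂ => (n : ℂ) ^ s * n.factorial)
      ((n : ℂ) ^ s * log n * 1 * n.factorial) s :=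
    ((hasDerivAt_id s).const_cpow (Or.inl hn')).mul_const _
  unfold GammaSeq
  rw [logDeriv_div s (by simp [hn', Nat.factorial_ne_zero])
    (Finset.prod_ne_zero_iff.2 fun k _ => add_natCast_ne_zero_of_re_pos hs k)
    h1.differentiableAt (by fun_prop),
    logDeriv_prod (fun k _ => add_natCast_ne_zero_of_re_pos hs k) (by fun_prop), digammaSeq]
  congr 1
  · rw [logDeriv_apply, h1.deriv, ← natCast_log]
    have : ((n : ℂ) ^ s) ≠ 0 := by simp [hn']
    have : (n.factorial : ℂ) ≠ 0 := by exact_mod_cast n.factorial_ne_zero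
    field_simp
  · refine Finset.sum_congr rfl fun k _ => ?_
    rw [logDeriv_apply, deriv_add_const, deriv_id'', one_div]

theorem ne_neg_nat_of_re_pos {s : ℂ} (hs : 0 < s.re) (m : ℕ) : s ≠ -m := fun h =>
  add_natCast_ne_zero_of_re_pos hs m (by rw [h]; ring)

theorem tendsto_digammaSeq_of_re_pos {s : ℂ} (hs : 0 < s.re) :
    Tendsto (digammaSeq s) atTop (𝓝 (digamma s)) := by
  set U : Set ℂ := {w | s.re / 2 < w.re ∧ w.re < s.re + 1}
  have hU : IsOpen U :=
    (isOpen_lt continuous_const continuous_re).inter (isOpen_lt continuous_re continuous_const)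
  have hpos : ∀ w ∈ U, 0 < w.re := fun w hw => (half_pos hs).trans hw.1
  have hsU : s ∈ U := ⟨by linarith, by linarith⟩
  have hd := tendsto_deriv_of_tendsto_of_norm_le (F := fun n w => GammaSeq w n) (f := Gamma)
    (M := Real.Gamma (s.re / 2) + Real.Gamma (s.re + 1)) hU
    (by
      filter_upwards [eventually_ne_atTop 0] with n hn w hw
      exact (differentiableAt_GammaSeq (hpos w hw) hn).differentiableWithinAt)
    (fun w hw => (differentiableAt_Gamma w
      (ne_neg_nat_of_re_pos (hpos w hw))).differentiableWithinAt)
    (fun w _ => GammaSeq_tendsto_Gamma w)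
    (by
      filter_upwards [eventually_ne_atTop 0] with n hn w hw
      exact norm_GammaSeq_le (half_pos hs) (by linarith) hw.1.le hw.2.le hn) hsU
  have h := hd.div (GammaSeq_tendsto_Gamma s) (Gamma_ne_zero (ne_neg_nat_of_re_pos hs))
  refine h.congr' ?_
  filter_upwards [eventually_ne_atTop 0] with n hn
  exact logDeriv_GammaSeq hs hn

theorem digammaSeq_add_one (s : ℂ) (n : ℕ) :
    digammaSeq (s + 1) n = digammaSeq s n + s⁻¹ - (s + 1 + n)⁻¹ := by
  have : ∑ k ∈ Finset.range (n + 1), (s + 1 + k)⁻¹ =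
      ∑ k ∈ Finset.range n, (s + (k + 1 : ℕ))⁻¹ + (s + 1 + n)⁻¹ := by
    rw [Finset.sum_range_succ]
    congr 1
    refine Finset.sum_congr rfl fun k _ => ?_
    push_cast
    ring
  rw [digammaSeq, digammaSeq, this, Finset.sum_range_succ' (fun k : ℕ => (s + k)⁻¹)]
  push_cast
  ring

theorem tendsto_inv_add_natCast (s : ℂ) : Tendsto (fun n : ℕ => (s + n)⁻¹) atTop (𝓝 0) := by
  exact tendsto_inv₀_cobounded.comp ((tendsto_const_add_cobounded s).comp
    tendsto_natCast_atTop_cobounded)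

/-- The recurrence `ψ(s+1) = ψ(s) + 1/s` carries the limit leftwards one unit at a time. Negative
real parts do occur: `1/4 ± iz/2` leaves the right half-plane when `|Im z| > 1/2`. -/
theorem tendsto_digammaSeq {s : ℂ} (hs : ∀ m : ℕ, s ≠ -m) :
    Tendsto (digammaSeq s) atTop (𝓝 (digamma s)) := by
  obtain ⟨N, hN⟩ := exists_nat_gt (-s.re)
  induction N generalizing s with
  | zero => exact tendsto_digammaSeq_of_re_pos (by simpa using hN)
  | succ N ih =>
    have h := ih (s := s + 1) (fun m hm => hs (m + 1) (by push_cast; linear_combination hm))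
      (by push_cast at hN; simp; linarith)
    rw [digamma_apply_add_one s hs] at h
    have h2 := (h.sub_const s⁻¹).add (tendsto_inv_add_natCast (s + 1))
    rw [add_sub_cancel_right, add_zero] at h2
    refine h2.congr fun n => ?_
    rw [digammaSeq_add_one]
    ring

theorem one_div_one_add_sq_le_arctan_sub (y : ℝ) :
    1 / (1 + y ^ 2) ≤ 3 * (Real.arctan (y + 1) - Real.arctan y) := by
  obtain ⟨c, hc, h⟩ := exists_deriv_eq_slope Real.arctan (lt_add_one y)
    Real.continuous_arctan.continuousOn Real.differentiable_arctan.differentiableOn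
  rw [(Real.hasDerivAt_arctan c).deriv, add_sub_cancel_left, div_one] at h
  rw [← h, mul_one_div, div_le_div_iff₀ (by positivity) (by positivity)]
  -- With `c` the mean value point in `(y, y+1)`, the claim is `1 + c² ≤ 3(1 + y²)`.
  nlinarith [hc.1, hc.2, mul_nonneg (sub_nonneg.2 hc.1.le) (sub_nonneg.2 hc.2.le),
    sq_nonneg (2 * y - 1), sq_nonneg (y - 1), sq_nonneg (c + y), sq_nonneg (c - 1)]

/-- Mean value inequality for `u ↦ u/w - log(w+u)` on `[0,1]`, whose derivative is `u / (w(w+u))`.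
The segment stays at height `Im w`, away from the cut of `log`, and `‖w‖ ≤ ‖w+u‖ + 1 ≤ 2‖w+u‖`. -/
theorem norm_inv_sub_log_add_one_sub_log_le {w : ℂ} (hw : 1 ≤ |w.im|) :
    ‖w⁻¹ - (log (w + 1) - log w)‖ ≤ 2 / ‖w‖ ^ 2 := by
  have hw1 : 1 ≤ ‖w‖ := hw.trans (abs_im_le_norm w)
  have him : ∀ u : ℝ, (w + u).im = w.im := fun u => by simp
  have hslit : ∀ u : ℝ, w + u ∈ slitPlane := fun u => by
    rw [mem_slitPlane_iff, him]
    right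
    intro h
    rw [h] at hw
    norm_num at hw
  have hw0 : w ≠ 0 := by rintro rfl; norm_num at hw1
  have hder : ∀ u ∈ Icc (0 : ℝ) 1, HasDerivWithinAt (fun u : ℝ => u * w⁻¹ - log (w + u))
      (1 * w⁻¹ - (w + u)⁻¹ * 1) (Icc 0 1) u := fun u _ => by
    have h1 : HasDerivAt (fun u : ℂ => u * w⁻¹ - log (w + u)) (1 * w⁻¹ - (w + u)⁻¹ * 1) u :=
      ((hasDerivAt_id _).mul_const _).sub
        ((hasDerivAt_log (hslit u)).comp (u : ℂ) ((hasDerivAt_id (u : ℂ)).const_add w))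
    exact h1.comp_ofReal.hasDerivWithinAt
  have hb : ∀ u ∈ Icc (0 : ℝ) 1, ‖1 * w⁻¹ - (w + u)⁻¹ * 1‖ ≤ 2 / ‖w‖ ^ 2 := fun u hu => by
    have hu0 : w + u ≠ 0 := slitPlane_ne_zero (hslit u)
    have hge : ‖w‖ ≤ 2 * ‖w + u‖ := by
      have h1 : 1 ≤ ‖w + u‖ := by
        refine le_trans ?_ (abs_im_le_norm (w + u))
        rwa [him]
      have h2 : ‖w‖ ≤ ‖w + u‖ + ‖(u : ℂ)‖ := by
        simpa using norm_sub_le (w + u) u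
      rw [norm_real, Real.norm_of_nonneg hu.1] at h2
      linarith [hu.2]
    have he : 1 * w⁻¹ - (w + u)⁻¹ * 1 = u / (w * (w + u)) := by
      field_simp
      ring
    rw [he, norm_div, norm_mul, norm_real, Real.norm_of_nonneg hu.1]
    have h0 : 0 < ‖w‖ := by positivity
    have h0' : 0 < ‖w + u‖ := by positivity
    rw [div_le_div_iff₀ (by positivity) (by positivity)]
    nlinarith [hu.2, hu.1, mul_le_mul_of_nonneg_left hge h0.le,
      mul_nonneg h0.le h0.le]
  have := (convex_Icc (0 : ℝ) 1).norm_image_sub_le_of_norm_hasDerivWithin_le hder hb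
    (x := 0) (y := 1) (by simp) (by simp)
  simp only [ofReal_one, one_mul, ofReal_zero, zero_mul, add_zero, sub_zero, norm_one,
    mul_one] at this
  refine le_trans (le_of_eq ?_) this
  congr 1
  ring

/-- Up to sign and null terms, `ψ(s) - log s` is the sum over `k` of `1/(s+k) - (log(s+k+1) -
log(s+k))`. Each term is at most `2/(1 + (Re s + k)²)`, hence at most `6` times an increment of
`arctan`; these telescope to less than `6π`, uniformly in `Re s`. -/
theorem norm_digamma_sub_log_le {s : ℂ} (hs : 1 ≤ |s.im|) :
    ‖digamma s - log s‖ ≤ 6 * Real.pi := by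
  have him0 : s.im ≠ 0 := by rintro h; rw [h] at hs; norm_num at hs
  have hne : ∀ m : ℕ, s ≠ -m := fun m h => him0 (by rw [h]; simp)
  have hsum : ∀ n : ℕ, ‖∑ k ∈ Finset.range n,
      ((s + k)⁻¹ - (log (s + k + 1) - log (s + k)))‖ ≤ 6 * Real.pi := fun n => by
    have hk : ∀ k ∈ Finset.range n, ‖(s + k)⁻¹ - (log (s + k + 1) - log (s + k))‖ ≤
        6 * (Real.arctan (s.re + (k + 1 : ℕ)) - Real.arctan (s.re + k)) := fun k _ => by
      have him : (s + k).im = s.im := by simp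
      refine (norm_inv_sub_log_add_one_sub_log_le (by rwa [him])).trans ?_
      have h1 := one_div_one_add_sq_le_arctan_sub (s.re + k)
      have h2 : 1 + (s.re + k) ^ 2 ≤ ‖s + k‖ ^ 2 := by
        rw [← normSq_eq_norm_sq, normSq_apply, him]
        simp only [add_re, natCast_re]
        nlinarith [sq_abs s.im]
      have h3 : 1 / ‖s + k‖ ^ 2 ≤ 1 / (1 + (s.re + k) ^ 2) :=
        one_div_le_one_div_of_le (by positivity) h2
      rw [show (2 : ℝ) / ‖s + k‖ ^ 2 = 2 * (1 / ‖s + k‖ ^ 2) by ring]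
      push_cast
      rw [← add_assoc]
      linarith
    refine (norm_sum_le_of_le _ hk).trans ?_
    rw [← Finset.mul_sum, Finset.sum_range_sub (fun k : ℕ => Real.arctan (s.re + k))]
    have h1 := Real.arctan_lt_pi_div_two (s.re + n)
    have h2 := Real.neg_pi_div_two_lt_arctan s.re
    rw [Nat.cast_zero, add_zero]
    linarith
  have hlog : Tendsto (fun n : ℕ => log (s + n) - Real.log n) atTop (𝓝 0) := by
    have h1 : Tendsto (fun n : ℕ => log (1 + s * (0 + (n : ℂ))⁻¹)) atTop (𝓝 (log (1 + s * 0))) := by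
      refine Tendsto.clog ((tendsto_inv_add_natCast 0).const_mul s |>.const_add 1) ?_
      simp
    rw [mul_zero, add_zero, log_one] at h1
    refine h1.congr' ?_
    filter_upwards [eventually_ne_atTop 0] with n hn
    have hn' : (n : ℂ) ≠ 0 := Nat.cast_ne_zero.2 hn
    have h0 : 1 + s * (0 + (n : ℂ))⁻¹ ≠ 0 := by
      intro h
      rw [zero_add] at h
      field_simp at h
      exact hne n (by linear_combination h)
    rw [eq_sub_iff_add_eq', ← log_ofReal_mul (by positivity) h0]
    congr 1
    rw [ofReal_natCast, zero_add, mul_add, mul_one, mul_left_comm, mul_inv_cancel₀ hn', mul_one,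
      add_comm]
  have hlim : Tendsto (fun n : ℕ => digammaSeq s n - log s + (log (s + n) - Real.log n) +
      (s + n)⁻¹) atTop (𝓝 (digamma s - log s)) := by
    simpa using (((tendsto_digammaSeq hne).sub_const (log s)).add hlog).add
      (tendsto_inv_add_natCast s)
  refine le_of_tendsto hlim.norm (Eventually.of_forall fun n => ?_)
  refine le_trans (le_of_eq ?_) (hsum n)
  rw [Finset.sum_sub_distrib]
  have ht : ∑ k ∈ Finset.range n, (log (s + k + 1) - log (s + k)) = log (s + n) - log s := by
    have := Finset.sum_range_sub (fun k : ℕ => log (s + k)) n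
    simp only [Nat.cast_add, Nat.cast_one, ← add_assoc, Nat.cast_zero, add_zero] at this
    exact this
  rw [ht, digammaSeq, Finset.sum_range_succ, ← norm_neg]
  congr 1
  ring

/-! ### The theta function -/

/-- Only `O(1)` precision is wanted, so the arguments are simply bounded by `π` each. -/
theorem norm_log_sub_log_le (a b : ℂ) :
    ‖log a - log b‖ ≤ |Real.log ‖a‖ - Real.log ‖b‖| + 2 * Real.pi := by
  refine (norm_le_abs_re_add_abs_im _).trans ?_
  rw [sub_re, sub_im, log_re, log_re]
  gcongr
  have h1 := abs_le.1 (abs_arg_le_pi a)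
  have h2 := abs_le.1 (abs_arg_le_pi b)
  rw [log_im, log_im, abs_le]
  constructor <;> linarith

theorem abs_log_sub_log_le {a b : ℝ} (hb : 0 < b) (h1 : b / 4 ≤ a) (h2 : a ≤ b) :
    |Real.log a - Real.log b| ≤ Real.log 4 := by
  have ha : 0 < a := by linarith
  have e1 := Real.log_le_log (by positivity) h1
  have e2 := Real.log_le_log ha h2
  rw [Real.log_div hb.ne' (by norm_num)] at e1
  have := Real.log_nonneg (show (1 : ℝ) ≤ 4 by norm_num)
  rw [abs_le]
  constructor <;> linarith

/-- The digamma arguments `1/4 ± iz/2` have imaginary parts `±Re z / 2`, of modulus at least `1`,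
and moduli between `‖z‖/4` and `‖z‖`, so their logarithms are `log z + O(1)`. -/
theorem exists_norm_thetaDensity_sub_log_le :
    ∃ K, 0 < K ∧ ∀ z : ℂ, 2 ≤ z.re → ‖thetaDensity z - log z / 2‖ ≤ K := by
  have key : ∀ z a : ℂ, 2 ≤ z.re → ‖a‖ = ‖z‖ / 2 → 1 ≤ |(1 / 4 + a).im| →
      ‖digamma (1 / 4 + a) - log z‖ ≤ 6 * Real.pi + (Real.log 4 + 2 * Real.pi) := by
    intro z a hz ha him
    have hz2 : 2 ≤ ‖z‖ := hz.trans (re_le_norm z)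
    refine (norm_sub_le_norm_sub_add_norm_sub _ (log (1 / 4 + a)) _).trans ?_
    refine add_le_add (norm_digamma_sub_log_le him) ((norm_log_sub_log_le _ _).trans ?_)
    have e1 : ‖(1 / 4 + a : ℂ)‖ ≤ 1 / 4 + ‖z‖ / 2 := by
      simpa [ha] using norm_add_le (1 / 4 : ℂ) a
    have e2 : ‖z‖ / 2 ≤ ‖(1 / 4 + a : ℂ)‖ + 1 / 4 := by
      have := norm_sub_le (1 / 4 + a : ℂ) (1 / 4)
      rw [add_sub_cancel_left, ha] at this
      simpa using this
    gcongr
    exact abs_log_sub_log_le (by linarith) (by linarith) (by linarith)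
  have hpi := Real.pi_pos
  have hl4 := Real.log_nonneg (show (1 : ℝ) ≤ 4 by norm_num)
  have hlp := Real.log_nonneg (show (1 : ℝ) ≤ Real.pi by linarith [Real.pi_gt_three])
  refine ⟨(6 * Real.pi + (Real.log 4 + 2 * Real.pi)) / 2 + Real.log Real.pi / 2, by positivity,
    fun z hz => ?_⟩
  have h1 := key z (I * z / 2) hz (by simp) (by simp; rw [abs_of_nonneg] <;> linarith)
  have h2 := key z (-(I * z / 2)) hz (by simp)
    (by simp; rw [abs_of_nonneg] <;> linarith)
  have e : thetaDensity z - log z / 2 = (digamma (1 / 4 + I * z / 2) - log z) / 4 +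
      (digamma (1 / 4 + -(I * z / 2)) - log z) / 4 - Real.log Real.pi / 2 := by
    rw [thetaDensity, sub_eq_add_neg (1 / 4 : ℂ)]
    ring
  rw [e]
  refine (norm_sub_le _ _).trans ?_
  have e3 : ‖(Real.log Real.pi / 2 : ℂ)‖ = Real.log Real.pi / 2 := by
    rw [norm_div, norm_real, Real.norm_of_nonneg hlp]
    simp
  rw [e3]
  gcongr
  refine (norm_add_le _ _).trans ?_
  rw [norm_div, norm_div, show ‖(4 : ℂ)‖ = 4 by simp]
  linarith

theorem thetaDensity_neg (z : ℂ) : thetaDensity (-z) = thetaDensity z := by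
  rw [thetaDensity, thetaDensity, mul_neg, neg_div, sub_neg_eq_add, ← sub_eq_add_neg,
    add_comm (digamma _)]

theorem mem_cutPlane_of_re_pos {z : ℂ} (hz : 0 < z.re) : z ∈ cutPlane := Or.inl hz.ne'

theorem ofReal_mem_cutPlane (u : ℝ) : (u : ℂ) ∈ cutPlane := by
  right
  simp

theorem differentiableAt_thetaDensity {z : ℂ} (hz : z ∈ cutPlane) :
    DifferentiableAt ℂ thetaDensity z :=
  differentiableOn_thetaDensity.differentiableAt (isOpen_cutPlane.mem_nhds hz)

theorem differentiableAt_deriv_thetaDensity {z : ℂ} (hz : z ∈ cutPlane) :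
    DifferentiableAt ℂ (deriv thetaDensity) z :=
  (differentiableOn_thetaDensity.deriv isOpen_cutPlane).differentiableAt
    (isOpen_cutPlane.mem_nhds hz)

theorem deriv_theta {z : ℂ} (hz : z ∈ cutPlane) : deriv theta z = thetaDensity z :=
  (hasDerivAt_theta hz).deriv

theorem deriv_deriv_theta {z : ℂ} (hz : z ∈ cutPlane) :
    deriv (deriv theta) z = deriv thetaDensity z := by
  refine EventuallyEq.deriv_eq ?_
  filter_upwards [isOpen_cutPlane.mem_nhds hz] with w hw using deriv_theta hw

theorem half_re_le_of_mem_closedBall {z w : ℂ} (hw : w ∈ Metric.closedBall z (z.re / 2)) :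
    z.re / 2 ≤ w.re := by
  rw [mem_closedBall_iff_norm] at hw
  have := (abs_le.1 ((abs_re_le_norm (w - z)).trans hw)).1
  rw [sub_re] at this
  linarith

theorem diffContOnCl_ball_of_re_pos {f : ℂ → ℂ}
    (hf : ∀ z : ℂ, 0 < z.re → DifferentiableAt ℂ f z) {z : ℂ} (hz : 0 < z.re) :
    DiffContOnCl ℂ f (Metric.ball z (z.re / 2)) := by
  refine DifferentiableOn.diffContOnCl fun w hw => ?_
  have := half_re_le_of_mem_closedBall (Metric.closure_ball_subset_closedBall hw)
  exact (hf w (by linarith)).differentiableWithinAt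

/-- Cauchy's estimate is applied to `ϑ' - (log z)/2`, which is bounded, rather than to `ϑ'`; this
avoids a spurious logarithm. -/
theorem exists_norm_deriv_thetaDensity_le :
    ∃ K, 0 < K ∧ ∀ z : ℂ, 4 ≤ z.re → ‖deriv thetaDensity z‖ ≤ K / z.re := by
  obtain ⟨K, hK0, hK⟩ := exists_norm_thetaDensity_sub_log_le
  refine ⟨2 * K + 1, by positivity, fun z hz => ?_⟩
  have hz0 : 0 < z.re := by linarith
  have hslit : ∀ w : ℂ, 0 < w.re → w ∈ slitPlane := fun w hw => Or.inl hw
  have hd : ∀ w : ℂ, 0 < w.re →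
      DifferentiableAt ℂ (fun w => thetaDensity w - log w / 2) w := fun w hw =>
    (differentiableAt_thetaDensity (mem_cutPlane_of_re_pos hw)).sub
      ((differentiableAt_log (hslit w hw)).div_const 2)
  have h1 := norm_deriv_le_of_forall_mem_sphere_norm_le (half_pos hz0)
    (diffContOnCl_ball_of_re_pos hd hz0) (C := K) fun w hw => hK w (by
      have := half_re_le_of_mem_closedBall (Metric.sphere_subset_closedBall hw)
      linarith)
  have h2 : HasDerivAt (fun w => thetaDensity w - log w / 2)
      (deriv thetaDensity z - z⁻¹ / 2) z :=
    (differentiableAt_thetaDensity (mem_cutPlane_of_re_pos hz0)).hasDerivAt.sub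
      ((hasDerivAt_log (hslit z hz0)).div_const 2)
  rw [h2.deriv] at h1
  have h3 : ‖z⁻¹ / 2‖ ≤ 1 / z.re := by
    rw [norm_div, norm_inv, show ‖(2 : ℂ)‖ = 2 by simp, ← one_div, div_div]
    exact one_div_le_one_div_of_le hz0 (by linarith [re_le_norm z])
  calc ‖deriv thetaDensity z‖ = ‖(deriv thetaDensity z - z⁻¹ / 2) + z⁻¹ / 2‖ := by
        rw [sub_add_cancel]
    _ ≤ K / (z.re / 2) + 1 / z.re := (norm_add_le _ _).trans (add_le_add h1 h3)
    _ = _ := by field_simp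

theorem exists_norm_deriv_deriv_thetaDensity_le :
    ∃ K, 0 < K ∧ ∀ z : ℂ, 8 ≤ z.re → ‖deriv (deriv thetaDensity) z‖ ≤ K / z.re ^ 2 := by
  obtain ⟨K, hK0, hK⟩ := exists_norm_deriv_thetaDensity_le
  refine ⟨4 * K, by positivity, fun z hz => ?_⟩
  have hz0 : 0 < z.re := by linarith
  have h1 := norm_deriv_le_of_forall_mem_sphere_norm_le (half_pos hz0)
    (diffContOnCl_ball_of_re_pos
      (fun w hw => differentiableAt_deriv_thetaDensity (mem_cutPlane_of_re_pos hw)) hz0)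
    (C := K / (z.re / 2)) fun w hw => by
      have := half_re_le_of_mem_closedBall (Metric.sphere_subset_closedBall hw)
      exact (hK w (by linarith)).trans (by gcongr)
  refine h1.trans (le_of_eq ?_)
  field_simp
  norm_num

/-- The second order Taylor formula for a function of a complex variable on a disc. -/
theorem norm_taylor_two_le {f f' f'' f''' : ℂ → ℂ} {c : ℂ} {r M : ℝ}
    (h1 : ∀ z ∈ Metric.closedBall c r, HasDerivAt f (f' z) z)
    (h2 : ∀ z ∈ Metric.closedBall c r, HasDerivAt f' (f'' z) z)
    (h3 : ∀ z ∈ Metric.closedBall c r, HasDerivAt f'' (f''' z) z)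
    (hM : ∀ z ∈ Metric.closedBall c r, ‖f''' z‖ ≤ M) {x : ℂ} (hx : ‖x‖ ≤ r) :
    ‖f (c + x) - f c - x * f' c - x ^ 2 / 2 * f'' c‖ ≤ M * r ^ 3 := by
  have hr : 0 ≤ r := (norm_nonneg x).trans hx
  have hc : c ∈ Metric.closedBall c r := Metric.mem_closedBall_self hr
  have hM0 : 0 ≤ M := (norm_nonneg _).trans (hM c hc)
  have hcv := convex_closedBall c r
  have hnorm : ∀ z ∈ Metric.closedBall c r, ‖z - c‖ ≤ r := fun z hz => mem_closedBall_iff_norm.1 hz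
  have b2 : ∀ z ∈ Metric.closedBall c r, ‖f'' z - f'' c‖ ≤ M * r := fun z hz =>
    (hcv.norm_image_sub_le_of_norm_hasDerivWithin_le
      (fun w hw => (h3 w hw).hasDerivWithinAt) hM hc hz).trans
      (by gcongr; exact hnorm z hz)
  have b1 : ∀ z ∈ Metric.closedBall c r, ‖f' z - f' c - (z - c) * f'' c‖ ≤ M * r * r := by
    intro z hz
    have := hcv.norm_image_sub_le_of_norm_hasDerivWithin_le
      (f := fun z => f' z - (z - c) * f'' c) (f' := fun z => f'' z - 1 * f'' c)
      (fun w hw => ((h2 w hw).sub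
        (((hasDerivAt_id w).sub_const c).mul_const (f'' c))).hasDerivWithinAt)
      (fun w hw => by simpa using b2 w hw) hc hz
    refine le_trans (le_of_eq ?_) (this.trans (by gcongr; exact hnorm z hz))
    congr 1
    ring
  have hx' : c + x ∈ Metric.closedBall c r := by simpa [mem_closedBall_iff_norm] using hx
  have := hcv.norm_image_sub_le_of_norm_hasDerivWithin_le
    (f := fun z => f z - (z - c) * f' c - (z - c) ^ 2 / 2 * f'' c)
    (f' := fun z => f' z - 1 * f' c - (2 : ℕ) * (z - c) ^ (2 - 1) * 1 / 2 * f'' c)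
    (fun w hw => (((h1 w hw).sub
      (((hasDerivAt_id w).sub_const c).mul_const (f' c))).sub
      (((((hasDerivAt_id w).sub_const c).pow 2).div_const 2).mul_const (f'' c))).hasDerivWithinAt)
    (C := M * r * r)
    (fun w hw => le_trans (le_of_eq (by congr 1; push_cast; ring)) (b1 w hw)) hc hx'
  refine le_trans (le_of_eq ?_) (this.trans
    ((mul_le_mul_of_nonneg_left (hnorm _ hx') (by positivity)).trans (le_of_eq (by ring))))
  congr 1
  simp only [add_sub_cancel_left, sub_self]
  ring

theorem exists_norm_theta_taylor_le :
    ∃ K, 0 < K ∧ ∀ (t : ℝ) (x : ℂ), 16 ≤ t → ‖x‖ ≤ t / 2 →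
      ‖theta (t + x) - theta t - x * thetaDensity t - x ^ 2 / 2 * deriv thetaDensity t‖ ≤
        K * ‖x‖ ^ 3 / t ^ 2 := by
  obtain ⟨K, hK0, hK⟩ := exists_norm_deriv_deriv_thetaDensity_le
  refine ⟨4 * K, by positivity, fun t x ht hx => ?_⟩
  have hre : ∀ z ∈ Metric.closedBall (t : ℂ) ‖x‖, t / 2 ≤ z.re := fun z hz =>
    half_re_le_of_mem_closedBall (z := t) (Metric.closedBall_subset_closedBall (by simpa) hz)
  have hcut : ∀ z ∈ Metric.closedBall (t : ℂ) ‖x‖, z ∈ cutPlane := fun z hz =>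
    mem_cutPlane_of_re_pos (by linarith [hre z hz])
  refine (norm_taylor_two_le (fun z hz => hasDerivAt_theta (hcut z hz))
    (fun z hz => (differentiableAt_thetaDensity (hcut z hz)).hasDerivAt)
    (fun z hz => (differentiableAt_deriv_thetaDensity (hcut z hz)).hasDerivAt)
    (M := K / (t / 2) ^ 2) (fun z hz => ?_) le_rfl).trans (le_of_eq ?_)
  · have h := hre z hz
    refine (hK z (by linarith)).trans ?_
    gcongr
  · field_simp
    ring

/-- For real `u` the two Gamma values are complex conjugates and `π^(-iu)` has modulus one, so
`exp(2iϑ(u))` is unimodular. -/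
theorem norm_exp_I_mul_theta_ofReal (u : ℝ) : ‖exp (I * theta u)‖ = 1 := by
  have h := congrArg norm (exp_theta (ofReal_mem_cutPlane u))
  have hG : Gamma (1 / 4 - I * u / 2) = (starRingEnd ℂ) (Gamma (1 / 4 + I * u / 2)) := by
    rw [← Gamma_conj]
    congr 1
    simp [map_ofNat]
    ring
  rw [norm_div, norm_mul, hG, RCLike.norm_conj,
    norm_cpow_eq_rpow_re_of_pos Real.pi_pos] at h
  have hne : ‖Gamma (1 / 4 + I * u / 2)‖ ≠ 0 :=
    norm_ne_zero_iff.2 (Gamma_ne_zero (add_ne_neg_nat (ofReal_mem_cutPlane u)))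
  rw [mul_div_assoc, div_self hne, show (-I * (u : ℂ)).re = 0 by simp, Real.rpow_zero, one_mul,
    show 2 * I * theta u = I * theta u + I * theta u by ring, exp_add, norm_mul] at h
  nlinarith [norm_nonneg (exp (I * theta u))]

theorem theta_ofReal_im (u : ℝ) : (theta u).im = 0 := by
  have := norm_exp_I_mul_theta_ofReal u
  rw [norm_exp, Real.exp_eq_one_iff] at this
  simpa using this

theorem thetaDensity_ofReal_im (u : ℝ) : (thetaDensity u).im = 0 := by
  have h := (hasDerivAt_theta (ofReal_mem_cutPlane u)).comp_ofReal
  have h2 := imCLM.hasFDerivAt.comp_hasDerivAt u h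
  have h3 : (imCLM ∘ fun u : ℝ => theta u) = fun _ => 0 := by
    ext v
    exact theta_ofReal_im v
  rw [h3] at h2
  exact h2.unique (hasDerivAt_const u 0)

theorem exists_norm_thetaDensity_le :
    ∃ K, 0 < K ∧ ∀ z : ℂ, 2 ≤ |z.re| → ‖thetaDensity z‖ ≤ Real.log ‖z‖ / 2 + K := by
  obtain ⟨K, hK0, hK⟩ := exists_norm_thetaDensity_sub_log_le
  have key : ∀ z : ℂ, 2 ≤ z.re → ‖thetaDensity z‖ ≤ Real.log ‖z‖ / 2 + (K + Real.pi) := by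
    intro z hz
    have h1 : ‖log z‖ ≤ Real.log ‖z‖ + Real.pi := by
      refine (norm_le_abs_re_add_abs_im _).trans ?_
      rw [log_re, log_im, abs_of_nonneg (Real.log_nonneg (by linarith [re_le_norm z]))]
      gcongr
      exact abs_arg_le_pi z
    calc ‖thetaDensity z‖ = ‖(thetaDensity z - log z / 2) + log z / 2‖ := by
          rw [sub_add_cancel]
      _ ≤ K + ‖log z‖ / 2 := (norm_add_le _ _).trans (add_le_add (hK z hz) (by simp))
      _ ≤ _ := by linarith [Real.pi_pos]
  refine ⟨K + Real.pi, by positivity, fun z hz => ?_⟩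
  rcases le_total 0 z.re with h | h
  · exact key z (by rwa [abs_of_nonneg h] at hz)
  · rw [← thetaDensity_neg, ← norm_neg z]
    exact key (-z) (by rwa [abs_of_nonpos h] at hz)

/-- Move vertically from the real point `u`, where `ϑ` is real. Along the way `|ϑ'| ≤ log(|u|+2)/2 +
K`, and a path of length at most `2` changes `ϑ` by at most `log(|u|+2) + 2K`. -/
theorem exists_norm_exp_I_mul_theta_le :
    ∃ K, 0 < K ∧ ∀ u τ : ℝ, 2 ≤ |u| → 0 ≤ τ → τ ≤ 2 →
      ‖exp (I * theta (u - I * τ))‖ ≤ K * (|u| + 2) := by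
  obtain ⟨K, hK0, hK⟩ := exists_norm_thetaDensity_le
  refine ⟨Real.exp (2 * K), by positivity, fun u τ hu h0 h2 => ?_⟩
  have hre : ∀ v : ℝ, ((u : ℂ) - I * v).re = u := fun v => by simp
  have hcut : ∀ v : ℝ, (u : ℂ) - I * v ∈ cutPlane := fun v => by
    left
    rw [hre]
    rintro rfl
    norm_num at hu
  have hder : ∀ v ∈ Icc (0 : ℝ) 2, HasDerivWithinAt (fun v : ℝ => theta (u - I * v))
      (thetaDensity (u - I * v) * -(I * 1)) (Icc 0 2) v := fun v _ => by
    have h1 : HasDerivAt (fun v : ℂ => theta (u - I * v))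
        (thetaDensity (u - I * v) * -(I * 1)) v :=
      HasDerivAt.comp (h₂ := theta) (v : ℂ) (hasDerivAt_theta (hcut v))
        (((hasDerivAt_id (v : ℂ)).const_mul I).const_sub (u : ℂ))
    exact h1.comp_ofReal.hasDerivWithinAt
  have hb : ∀ v ∈ Icc (0 : ℝ) 2, ‖thetaDensity (u - I * v) * -(I * 1)‖ ≤
      Real.log (|u| + 2) / 2 + K := fun v hv => by
    rw [norm_mul, norm_neg, mul_one, norm_I, mul_one]
    have hn : ‖(u : ℂ) - I * v‖ ≤ |u| + 2 := by
      refine (norm_sub_le _ _).trans ?_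
      rw [norm_mul, norm_I, one_mul, norm_real, norm_real, Real.norm_eq_abs,
        Real.norm_of_nonneg hv.1]
      linarith [hv.2]
    have hp : 0 < ‖(u : ℂ) - I * v‖ := by
      have := abs_re_le_norm ((u : ℂ) - I * v)
      rw [hre] at this
      linarith
    refine (hK _ (by rwa [hre])).trans ?_
    gcongr
  have hmv := (convex_Icc (0 : ℝ) 2).norm_image_sub_le_of_norm_hasDerivWithin_le hder hb
    (x := 0) (y := τ) (by simp) ⟨h0, h2⟩
  have hlog : 0 ≤ Real.log (|u| + 2) := Real.log_nonneg (by linarith)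
  rw [ofReal_zero, mul_zero, sub_zero, sub_zero, Real.norm_of_nonneg h0] at hmv
  have hfin : ‖theta (u - I * τ) - theta u‖ ≤ Real.log (|u| + 2) + 2 * K := by
    nlinarith
  rw [norm_exp]
  have him : (I * theta (u - I * τ)).re ≤ ‖theta (u - I * τ) - theta u‖ := by
    have h := (neg_le_abs _).trans (abs_im_le_norm (theta (u - I * τ) - theta u))
    rw [sub_im, theta_ofReal_im, sub_zero] at h
    simpa using h
  calc Real.exp (I * theta (u - I * τ)).re ≤ Real.exp (Real.log (|u| + 2) + 2 * K) :=
        Real.exp_le_exp.2 (him.trans hfin)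
    _ = Real.exp (2 * K) * (|u| + 2) := by
        rw [Real.exp_add, Real.exp_log (by linarith), mul_comm]

/-- For `σ < 1/2` the whole line avoids the cuts, so compactness handles `|u| ≤ 2`. -/
theorem exists_norm_exp_I_mul_theta_le_of_lt_half {σ : ℝ} (h0 : 0 < σ) (h1 : σ < 1 / 2) :
    ∃ K, 0 < K ∧ ∀ u : ℝ, ‖exp (I * theta (u - I * σ))‖ ≤ K * (|u| + 2) := by
  obtain ⟨K, hK0, hK⟩ := exists_norm_exp_I_mul_theta_le
  have hcut : ∀ u : ℝ, (u : ℂ) - I * σ ∈ cutPlane := fun u => by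
    right
    simpa [abs_of_pos h0] using h1
  have hc : Continuous fun u : ℝ => exp (I * theta (u - I * σ)) := by
    refine continuous_iff_continuousAt.2 fun u => ?_
    have h := ContinuousAt.comp (f := fun u : ℝ => (u : ℂ) - I * σ) (x := u)
      (hasDerivAt_theta (hcut u)).continuousAt (by fun_prop)
    exact (h.const_mul I).cexp
  obtain ⟨M, hM⟩ := isCompact_Icc.exists_bound_of_continuousOn (s := Icc (-2 : ℝ) 2)
    hc.continuousOn
  refine ⟨K + |M|, by positivity, fun u => ?_⟩
  have hu := abs_nonneg u
  have hM' := abs_nonneg M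
  rcases le_total 2 |u| with h | h
  · refine (hK u σ h h0.le (by linarith)).trans ?_
    nlinarith
  · refine (hM u (abs_le.1 h)).trans ((le_abs_self M).trans ?_)
    nlinarith

/-- Since `ϑ'(t)` is real, the linear phase contributes `τ ϑ'(t) ≤ (τ/2) log t + 2K` to the
exponent. The quadratic phase is `O(1)` because `ϑ''(t) = O(1/t)` and `‖x‖² ≤ t`. -/
theorem exists_norm_exp_taylor_le :
    ∃ K, 0 < K ∧ ∀ t y τ : ℝ, 16 ≤ t → 0 ≤ τ → τ ≤ 2 → ‖(y - I * τ : ℂ)‖ ^ 2 ≤ t →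
      ‖exp (I * (y - I * τ) * deriv theta t +
        I * ((y - I * τ) ^ 2 / 2) * deriv (deriv theta) t)‖ ≤ K * t ^ (τ / 2) := by
  obtain ⟨K, hK0, hK⟩ := exists_norm_thetaDensity_le
  obtain ⟨K', hK'0, hK'⟩ := exists_norm_deriv_thetaDensity_le
  refine ⟨Real.exp (2 * K + K'), by positivity, fun t y τ ht h0 h2 hx => ?_⟩
  have ht0 : 0 < t := by linarith
  have hcut := ofReal_mem_cutPlane t
  rw [deriv_theta hcut, deriv_deriv_theta hcut, norm_exp, Real.rpow_def_of_pos ht0, ← Real.exp_add]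
  refine Real.exp_le_exp.2 ?_
  rw [add_re]
  have e1 : (I * (y - I * τ) * thetaDensity t).re ≤ Real.log t * (τ / 2) + 2 * K := by
    have h := hK t (by simpa [abs_of_pos ht0] using (by linarith : (2 : ℝ) ≤ t))
    rw [norm_real, Real.norm_of_nonneg ht0.le] at h
    have h' := (re_le_norm (thetaDensity t)).trans h
    have : (I * (y - I * τ) * thetaDensity t).re = τ * (thetaDensity t).re := by
      rw [mul_re, thetaDensity_ofReal_im]
      simp
    rw [this]
    nlinarith
  have e2 : (I * ((y - I * τ) ^ 2 / 2) * deriv thetaDensity t).re ≤ K' := by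
    refine (re_le_norm _).trans ?_
    have h := hK' t (by simpa using (by linarith : (4 : ℝ) ≤ t))
    rw [ofReal_re] at h
    rw [norm_mul, norm_mul, norm_I, one_mul, norm_div, norm_pow, show ‖(2 : ℂ)‖ = 2 by simp]
    calc ‖(y - I * τ : ℂ)‖ ^ 2 / 2 * ‖deriv thetaDensity t‖ ≤ t / 2 * (K' / t) := by gcongr
      _ = K' / 2 := by field_simp
      _ ≤ K' := by linarith
  linarith

/-! ### The kernel -/

theorem normSq_sinh_add_mul_I (a b : ℝ) :
    normSq (sinh (a + b * I)) = Real.sinh a ^ 2 + Real.sin b ^ 2 := by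
  have h : sinh (a + b * I) =
      (Real.sinh a * Real.cos b : ℝ) + (Real.cosh a * Real.sin b : ℝ) * I := by
    rw [sinh_add, sinh_mul_I, cosh_mul_I]
    push_cast
    ring
  rw [h, normSq_add_mul_I]
  have h1 := Real.cosh_sq a
  have h2 := Real.sin_sq_add_cos_sq b
  linear_combination Real.sin b ^ 2 * h1 + Real.sinh a ^ 2 * h2

theorem normSq_sinh_pi_mul (x : ℂ) : normSq (sinh (Real.pi * x / 2)) =
    Real.sinh (Real.pi * x.re / 2) ^ 2 + Real.sin (Real.pi * x.im / 2) ^ 2 := by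
  rw [← normSq_sinh_add_mul_I]
  congr 2
  conv_lhs => rw [← re_add_im x]
  push_cast
  ring

theorem sin_pi_mul_div_two_ne_zero {v : ℝ} (h1 : -2 < v) (h2 : v < 0) :
    Real.sin (Real.pi * v / 2) ≠ 0 := by
  refine (Real.sin_neg_of_neg_of_neg_pi_lt ?_ ?_).ne <;> nlinarith [Real.pi_pos]

theorem sinh_pi_mul_ne_zero {x : ℂ} (h1 : -2 < x.im) (h2 : x.im < 0) :
    sinh (Real.pi * x / 2) ≠ 0 := by
  rw [← normSq_pos, normSq_sinh_pi_mul]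
  have := sin_pi_mul_div_two_ne_zero h1 h2
  positivity

/-- `|sinh(a+ib)|² = sinh² a + sin² b ≥ sinh² a`, and `π/2` is replaced by the smaller rate `3/2`.
-/
theorem norm_pi_div_two_sinh_le {x : ℂ} (hx : 1 ≤ |x.re|) :
    ‖(Real.pi / (2 * sinh (Real.pi * x / 2)) : ℂ)‖ ≤ 8 * Real.exp (-(3 / 2 * |x.re|)) := by
  have hpi := Real.pi_gt_three
  have hpi4 := Real.pi_le_four
  have h1 : Real.sinh (Real.pi * |x.re| / 2) ≤ ‖sinh (Real.pi * x / 2)‖ := by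
    refine le_of_sq_le_sq ?_ (norm_nonneg _)
    rw [← normSq_eq_norm_sq, normSq_sinh_pi_mul]
    have : Real.sinh (Real.pi * |x.re| / 2) ^ 2 = Real.sinh (Real.pi * x.re / 2) ^ 2 := by
      rw [← sq_abs (Real.sinh (Real.pi * x.re / 2)), Real.abs_sinh, abs_div, abs_mul,
        abs_of_pos Real.pi_pos, abs_two]
    rw [this]
    exact le_add_of_nonneg_right (sq_nonneg _)
  set a := Real.pi * |x.re| / 2 with ha
  have ha32 : 3 / 2 * |x.re| ≤ a := by nlinarith
  have h2 : Real.exp a / 4 ≤ Real.sinh a := by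
    rw [Real.sinh_eq]
    have e1 : Real.exp (-a) * Real.exp a = 1 := by rw [← Real.exp_add]; simp
    have e2 : 2 ≤ Real.exp a := by linarith [Real.add_one_le_exp a]
    have e3 := Real.exp_pos (-a)
    nlinarith
  have h3 : Real.exp (3 / 2 * |x.re|) / 4 ≤ ‖sinh (Real.pi * x / 2)‖ :=
    le_trans (by gcongr) (h2.trans h1)
  have hp := Real.exp_pos (3 / 2 * |x.re|)
  rw [norm_div, norm_mul, norm_real, Real.norm_of_nonneg Real.pi_pos.le, Real.exp_neg,
    show ‖(2 : ℂ)‖ = 2 by simp]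
  calc Real.pi / (2 * ‖sinh (Real.pi * x / 2)‖)
      ≤ 4 / (2 * (Real.exp (3 / 2 * |x.re|) / 4)) := by gcongr
    _ = _ := by field_simp; norm_num

theorem exists_norm_pi_div_two_sinh_le {τ : ℝ} (h0 : 0 < τ) (h2 : τ < 2) :
    ∃ K, 0 < K ∧ ∀ y : ℝ, ‖(Real.pi / (2 * sinh (Real.pi * (y - I * τ) / 2)) : ℂ)‖ ≤
      K * Real.exp (-(3 / 2 * |y|)) := by
  have hs := sin_pi_mul_div_two_ne_zero (v := -τ) (by linarith) (by linarith)
  set c := |Real.sin (Real.pi * -τ / 2)| with hc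
  have hc0 : 0 < c := abs_pos.2 hs
  refine ⟨8 + 4 / (2 * c) * Real.exp (3 / 2), by positivity, fun y => ?_⟩
  have hre : ((y : ℂ) - I * τ).re = y := by simp
  have him : ((y : ℂ) - I * τ).im = -τ := by simp
  rcases le_total 1 |y| with h | h
  · have := norm_pi_div_two_sinh_le (x := y - I * τ) (by rwa [hre])
    rw [hre] at this
    refine this.trans ?_
    gcongr
    exact le_add_of_nonneg_right (by positivity)
  · have h1 : c ≤ ‖sinh (Real.pi * (y - I * τ) / 2)‖ := by
      refine abs_le_of_sq_le_sq ?_ (norm_nonneg _)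
      rw [← normSq_eq_norm_sq, normSq_sinh_pi_mul, him]
      exact le_add_of_nonneg_left (sq_nonneg _)
    rw [norm_div, norm_mul, norm_real, Real.norm_of_nonneg Real.pi_pos.le,
      show ‖(2 : ℂ)‖ = 2 by simp]
    have hpi4 := Real.pi_le_four
    calc Real.pi / (2 * ‖sinh (Real.pi * (y - I * τ) / 2)‖) ≤ 4 / (2 * c) := by gcongr
      _ = 4 / (2 * c) * Real.exp (3 / 2) * Real.exp (-(3 / 2)) := by
          rw [mul_assoc, ← Real.exp_add]; simp
      _ ≤ (8 + 4 / (2 * c) * Real.exp (3 / 2)) * Real.exp (-(3 / 2 * |y|)) := by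
          gcongr
          · linarith
          · linarith

theorem half_add_I_mul_re (t y τ : ℝ) : (1 / 2 + I * (t + (y - I * τ)) : ℂ).re = 1 / 2 + τ := by
  simp

theorem half_add_I_mul_im (t y τ : ℝ) : (1 / 2 + I * (t + (y - I * τ)) : ℂ).im = t + y := by
  simp

theorem norm_half_add_I_mul_le {t y τ : ℝ} (h0 : 0 ≤ τ) :
    ‖(1 / 2 + I * (t + (y - I * τ)) : ℂ)‖ ≤ 1 / 2 + τ + |t + y| := by
  refine (norm_le_abs_re_add_abs_im _).trans ?_
  rw [half_add_I_mul_re, half_add_I_mul_im, abs_of_nonneg (by linarith)]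

theorem norm_riemannZeta_half_add_le {t y τ : ℝ} (h0 : 0 ≤ τ) (h2 : τ ≤ 2) (hy : 1 ≤ |t + y|) :
    ‖riemannZeta (1 / 2 + I * (t + (y - I * τ)))‖ ≤ 3 * (|t + y| + 3) := by
  set s : ℂ := 1 / 2 + I * (t + (y - I * τ)) with hs
  have hre : s.re = 1 / 2 + τ := half_add_I_mul_re t y τ
  have him : s.im = t + y := half_add_I_mul_im t y τ
  have h1 : 1 ≤ ‖s - 1‖ := by
    have := abs_im_le_norm (s - 1)
    rw [sub_im, one_im, sub_zero, him] at this
    linarith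
  have hs1 : s ≠ 1 := by
    intro h
    rw [h, sub_self, norm_zero] at h1
    linarith
  have hn : ‖s‖ ≤ |t + y| + 3 := by linarith [norm_half_add_I_mul_le (t := t) (y := y) h0]
  calc ‖riemannZeta s‖ ≤ ‖s‖ / ‖s - 1‖ + ‖s‖ / s.re := norm_riemannZeta_le (by linarith) hs1
    _ ≤ (|t + y| + 3) / 1 + (|t + y| + 3) / (1 / 2) := by
        gcongr
        linarith
    _ = _ := by ring

theorem exists_norm_riemannZeta_half_add_le {σ : ℝ} (h0 : 0 < σ) (h1 : σ < 1 / 2) :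
    ∃ K, 0 < K ∧ ∀ t y : ℝ,
      ‖riemannZeta (1 / 2 + I * (t + (y - I * σ)))‖ ≤ K * (|t + y| + 3) := by
  have hd : 0 < 1 / 2 - σ := by linarith
  refine ⟨1 / (1 / 2 - σ) + 2, by positivity, fun t y => ?_⟩
  set s : ℂ := 1 / 2 + I * (t + (y - I * σ)) with hs
  have hre : s.re = 1 / 2 + σ := half_add_I_mul_re t y σ
  have h1 : 1 / 2 - σ ≤ ‖s - 1‖ := by
    have := (neg_le_abs _).trans (abs_re_le_norm (s - 1))
    rw [sub_re, one_re, hre] at this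
    linarith
  have hs1 : s ≠ 1 := by
    intro h
    rw [h, sub_self, norm_zero] at h1
    linarith
  have hn : ‖s‖ ≤ |t + y| + 3 := by linarith [norm_half_add_I_mul_le (t := t) (y := y) h0.le]
  calc ‖riemannZeta s‖ ≤ ‖s‖ / ‖s - 1‖ + ‖s‖ / s.re := norm_riemannZeta_le (by linarith) hs1
    _ ≤ (|t + y| + 3) / (1 / 2 - σ) + (|t + y| + 3) / (1 / 2) := by
        gcongr
        linarith
    _ = _ := by ring

/-! ### Holomorphy and decay of the two integrands, and the contour shift. -/

theorem differentiableAt_kernel {t : ℝ} {x : ℂ} (h1 : -2 < x.im) (h2 : x.im < 0)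
    (h3 : 1 / 2 + I * (t + x) ≠ 1) : DifferentiableAt ℂ (kernel t) x := by
  unfold kernel
  refine DifferentiableAt.mul ?_ ?_
  · exact (differentiableAt_riemannZeta h3).comp x (by fun_prop)
  · refine (differentiableAt_const _).div (by fun_prop) ?_
    exact mul_ne_zero two_ne_zero (sinh_pi_mul_ne_zero h1 h2)

theorem differentiableAt_integrandU {t : ℝ} {x : ℂ} (h1 : -2 < x.im) (h2 : x.im < 0)
    (h3 : 1 / 2 + I * (t + x) ≠ 1) (h4 : t + x ∈ cutPlane) :
    DifferentiableAt ℂ (integrandU t) x := by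
  unfold integrandU
  refine DifferentiableAt.mul ?_ (differentiableAt_kernel h1 h2 h3)
  have : DifferentiableAt ℂ (fun x : ℂ => theta (t + x)) x :=
    (hasDerivAt_theta h4).differentiableAt.comp x (by fun_prop)
  fun_prop

theorem differentiableAt_integrandTaylor {t : ℝ} {x : ℂ} (h1 : -2 < x.im) (h2 : x.im < 0)
    (h3 : 1 / 2 + I * (t + x) ≠ 1) : DifferentiableAt ℂ (integrandTaylor t) x := by
  unfold integrandTaylor
  exact DifferentiableAt.mul (by fun_prop) (differentiableAt_kernel h1 h2 h3)

theorem norm_exp_sub_theta_ofReal (t : ℝ) (z : ℂ) :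
    ‖exp (I * theta z - I * theta t)‖ = ‖exp (I * theta z)‖ := by
  rw [exp_sub, norm_div, norm_exp_I_mul_theta_ofReal, div_one]

theorem add_three_sq_le_exp {v : ℝ} (hv : 0 ≤ v) :
    (v + 3) ^ 2 ≤ 128 * Real.exp (3 / 8) * Real.exp (1 / 4 * v) := by
  have h1 := Real.quadratic_le_exp_of_nonneg (x := (v + 3) / 8) (by positivity)
  have h2 : Real.exp ((v + 3) / 8) ≤ Real.exp (3 / 8) * Real.exp (1 / 4 * v) := by
    rw [← Real.exp_add]
    exact Real.exp_le_exp.2 (by linarith)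
  nlinarith

theorem exists_norm_integrandU_le {σ : ℝ} (h0 : 0 < σ) (h1 : σ < 1 / 2) :
    ∃ K, 0 < K ∧ ∀ t y : ℝ, ‖integrandU t (y - I * σ)‖ ≤
      K * (|t| + 3) ^ 2 * Real.exp (-(5 / 4 * |y|)) := by
  obtain ⟨A, hA0, hA⟩ := exists_norm_exp_I_mul_theta_le_of_lt_half h0 h1
  obtain ⟨B, hB0, hB⟩ := exists_norm_riemannZeta_half_add_le h0 h1
  obtain ⟨D, hD0, hD⟩ := exists_norm_pi_div_two_sinh_le h0 (by linarith)
  refine ⟨A * B * D * (128 * Real.exp (3 / 8)), by positivity, fun t y => ?_⟩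
  have hA' := hA (t + y)
  push_cast at hA'
  rw [add_sub_assoc] at hA'
  have ht := abs_nonneg t
  have hy := abs_nonneg y
  have hty : |t + y| + 3 ≤ (|t| + 3) * (|y| + 3) := by nlinarith [abs_add_le t y]
  rw [integrandU, kernel, norm_mul, norm_mul, norm_exp_sub_theta_ofReal]
  calc ‖exp (I * theta (t + (y - I * σ)))‖ * (‖riemannZeta (1 / 2 + I * (t + (y - I * σ)))‖ *
        ‖(Real.pi / (2 * sinh (Real.pi * (y - I * σ) / 2)) : ℂ)‖)
      ≤ A * (|t + y| + 3) * (B * (|t + y| + 3) * (D * Real.exp (-(3 / 2 * |y|)))) := by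
        gcongr
        · exact hA'.trans (by gcongr; norm_num)
        · exact hB t y
        · exact hD y
    _ ≤ A * ((|t| + 3) * (|y| + 3)) * (B * ((|t| + 3) * (|y| + 3)) *
        (D * Real.exp (-(3 / 2 * |y|)))) := by gcongr
    -- Of the decay rate `3/2`, a part `1/4` pays for the polynomial growth in `y`.
    _ = A * B * D * (|t| + 3) ^ 2 * ((|y| + 3) ^ 2 * Real.exp (-(3 / 2 * |y|))) := by ring
    _ ≤ A * B * D * (|t| + 3) ^ 2 * (128 * Real.exp (3 / 8) * Real.exp (1 / 4 * |y|) *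
        Real.exp (-(3 / 2 * |y|))) := by
        gcongr
        exact add_three_sq_le_exp hy
    _ = A * B * D * (|t| + 3) ^ 2 * (128 * Real.exp (3 / 8) * Real.exp (-(5 / 4 * |y|))) := by
        rw [mul_assoc (128 * Real.exp (3 / 8)), ← Real.exp_add]
        congr 4
        ring
    _ = _ := by ring

theorem integrable_exp_neg_mul_abs {c : ℝ} (hc : 0 < c) :
    Integrable fun y : ℝ => Real.exp (-(c * |y|)) := by
  rw [← integrableOn_univ, ← Iic_union_Ioi (a := (0 : ℝ))]
  refine IntegrableOn.union ?_ ?_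
  · refine (integrableOn_exp_mul_Iic hc 0).congr_fun (fun y hy => ?_) measurableSet_Iic
    simp only [abs_of_nonpos (show y ≤ 0 from hy), mul_neg, neg_neg]
  · refine (exp_neg_integrableOn_Ioi 0 hc).congr_fun (fun y hy => ?_) measurableSet_Ioi
    simp only [abs_of_pos (show 0 < y from hy), neg_mul]

theorem continuous_integrandU {σ : ℝ} (h0 : 0 < σ) (h1 : σ < 1 / 2) (t : ℝ) :
    Continuous fun y : ℝ => integrandU t (y - I * σ) := by
  refine continuous_iff_continuousAt.2 fun y => ?_
  refine ContinuousAt.comp (f := fun y : ℝ => (y : ℂ) - I * σ)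
    (differentiableAt_integrandU ?_ ?_ ?_ ?_).continuousAt (by fun_prop)
  · simp; linarith
  · simpa using h0
  · intro h
    have := congrArg re h
    rw [half_add_I_mul_re, one_re] at this
    linarith
  · right
    simpa [abs_of_pos h0] using h1

theorem integrable_integrandU {σ : ℝ} (h0 : 0 < σ) (h1 : σ < 1 / 2) (t : ℝ) :
    Integrable fun y : ℝ => integrandU t (y - I * σ) := by
  obtain ⟨K, hK0, hK⟩ := exists_norm_integrandU_le h0 h1
  exact ((integrable_exp_neg_mul_abs (c := 5 / 4) (by norm_num)).const_mul
    (K * (|t| + 3) ^ 2)).mono' (continuous_integrandU h0 h1 t).aestronglyMeasurable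
    (Eventually.of_forall (hK t))

theorem exists_norm_integral_sub_intervalIntegral_integrandU_le {σ : ℝ} (h0 : 0 < σ)
    (h1 : σ < 1 / 2) :
    ∃ K, 0 < K ∧ ∀ t b : ℝ, 0 ≤ b →
      ‖(∫ y : ℝ, integrandU t (y - I * σ)) - ∫ y in (-b)..b, integrandU t (y - I * σ)‖ ≤
        K * (|t| + 3) ^ 2 * Real.exp (-b) := by
  obtain ⟨K, hK0, hK⟩ := exists_norm_integrandU_le h0 h1
  set J := ∫ y : ℝ, Real.exp (-(1 / 4 * |y|)) with hJ
  have hJ0 : 0 ≤ J := integral_nonneg fun y => (Real.exp_pos _).le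
  refine ⟨K * (J + 1), by positivity, fun t b hb => ?_⟩
  have hint := integrable_integrandU h0 h1 t
  have hexp := integrable_exp_neg_mul_abs (c := 1 / 4) (by norm_num)
  rw [intervalIntegral.integral_of_le (by linarith),
    ← integral_add_compl measurableSet_Ioc hint, add_sub_cancel_left]
  calc ‖∫ y in (Ioc (-b) b)ᶜ, integrandU t (y - I * σ)‖
      ≤ ∫ y in (Ioc (-b) b)ᶜ, K * (|t| + 3) ^ 2 * Real.exp (-b) * Real.exp (-(1 / 4 * |y|)) := by
        refine norm_integral_le_of_norm_le (hexp.const_mul _).integrableOn ?_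
        refine (ae_restrict_iff' measurableSet_Ioc.compl).2 (Eventually.of_forall fun y hy => ?_)
        have hby : b ≤ |y| := by
          by_contra h
          have := abs_lt.1 (not_le.1 h)
          exact hy ⟨this.1, this.2.le⟩
        refine (hK t y).trans ?_
        -- The rate `5/4` splits as `1 + 1/4`: the first part yields `e^(-b)`, the second keeps the
        -- integral finite.
        rw [mul_assoc _ (Real.exp (-b)), ← Real.exp_add]
        gcongr
        linarith
    _ ≤ ∫ y : ℝ, K * (|t| + 3) ^ 2 * Real.exp (-b) * Real.exp (-(1 / 4 * |y|)) :=
        setIntegral_le_integral (hexp.const_mul _)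
          (Eventually.of_forall fun y => by positivity)
    _ = K * (|t| + 3) ^ 2 * Real.exp (-b) * J := integral_const_mul _ _
    _ ≤ K * (|t| + 3) ^ 2 * Real.exp (-b) * (J + 1) := by
        gcongr
        linarith
    _ = _ := by ring

/-- Moving a horizontal segment of integration vertically costs at most the integrals over the
vertical sides. -/
theorem norm_intervalIntegral_sub_le_of_rect {f : ℂ → ℂ} {b τ₁ τ₂ B : ℝ}
    (hf : ∀ y ∈ uIcc (-b) b, ∀ τ ∈ uIcc τ₁ τ₂, DifferentiableAt ℂ f (y - I * τ))
    (hr : ∀ τ ∈ uIcc τ₁ τ₂, ‖f ((b : ℝ) - I * τ)‖ ≤ B)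
    (hl : ∀ τ ∈ uIcc τ₁ τ₂, ‖f ((-b : ℝ) - I * τ)‖ ≤ B) :
    ‖(∫ y in (-b)..b, f (y - I * τ₁)) - ∫ y in (-b)..b, f (y - I * τ₂)‖ ≤
      2 * (B * |τ₂ - τ₁|) := by
  have hneg : ∀ v ∈ uIcc (-τ₁) (-τ₂), -v ∈ uIcc τ₁ τ₂ := fun v hv => by
    rw [mem_uIcc] at hv ⊢
    rcases hv with h | h
    · right; constructor <;> linarith
    · left; constructor <;> linarith
  have hcast : ∀ (y v : ℝ), (y + v * I : ℂ) = y - I * ((-v : ℝ) : ℂ) := fun y v => by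
    push_cast
    ring
  have H := integral_boundary_rect_eq_zero_of_differentiableOn f (-b - τ₁ * I) (b - τ₂ * I)
    (fun x hx => by
      rw [mem_reProdIm] at hx
      simp only [sub_re, neg_re, ofReal_re, mul_re, I_re, mul_zero, ofReal_im, I_im, mul_one,
        sub_self, sub_zero, sub_im, neg_im, neg_zero, mul_im, add_zero, zero_sub] at hx
      have := hf x.re hx.1 _ (hneg _ hx.2)
      rw [← hcast, re_add_im] at this
      exact this.differentiableWithinAt)
  simp only [sub_re, neg_re, ofReal_re, mul_re, I_re, mul_zero, ofReal_im, I_im, mul_one,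
    sub_self, sub_zero, sub_im, neg_im, neg_zero, mul_im, add_zero, zero_sub, hcast, neg_neg] at H
  have hside : ∀ c : ℝ, (∀ τ ∈ uIcc τ₁ τ₂, ‖f ((c : ℝ) - I * τ)‖ ≤ B) →
      ‖I • ∫ v in (-τ₁)..(-τ₂), f (c - I * ((-v : ℝ) : ℂ))‖ ≤ B * |τ₂ - τ₁| := fun c hc => by
    rw [norm_smul, norm_I, one_mul]
    refine (intervalIntegral.norm_integral_le_of_norm_le_const fun v hv =>
      hc (-v) (hneg v (uIoc_subset_uIcc hv))).trans (le_of_eq ?_)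
    rw [abs_sub_comm]
    congr 2
    ring
  have e : (∫ y in (-b)..b, f (y - I * τ₁)) - ∫ y in (-b)..b, f (y - I * τ₂) =
      (I • ∫ v in (-τ₁)..(-τ₂), f ((-b : ℝ) - I * ((-v : ℝ) : ℂ))) -
      I • ∫ v in (-τ₁)..(-τ₂), f (b - I * ((-v : ℝ) : ℂ)) := by
    push_cast at H ⊢
    linear_combination H
  rw [e, two_mul]
  exact (norm_sub_le _ _).trans (add_le_add (hside _ hl) (hside _ hr))

/-! ### Comparison of the two integrals -/

/-- For the vertical sides: `|y| ≥ 1` keeps `sinh` away from its zeros, so the bound is uniform in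
`τ`, endpoints included. -/
theorem norm_kernel_le {t y τ : ℝ} (ht : 16 ≤ t) (h0 : 0 ≤ τ) (h2 : τ ≤ 2) (hy1 : 1 ≤ |y|)
    (hyt : |y| ≤ t / 2) : ‖kernel t (y - I * τ)‖ ≤ 48 * t * Real.exp (-|y|) := by
  have hy := abs_le.1 hyt
  have hty : |t + y| = t + y := abs_of_nonneg (by linarith)
  have h1 := norm_riemannZeta_half_add_le (t := t) (y := y) h0 h2 (by rw [hty]; linarith)
  have hre : ((y : ℂ) - I * τ).re = y := by simp
  have h3 := norm_pi_div_two_sinh_le (x := y - I * τ) (by rwa [hre])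
  rw [hre] at h3
  rw [kernel, norm_mul]
  calc _ ≤ 3 * (|t + y| + 3) * (8 * Real.exp (-(3 / 2 * |y|))) := by gcongr
    _ ≤ 3 * (2 * t) * (8 * Real.exp (-|y|)) := by
        gcongr
        · rw [hty]; linarith
        · linarith
    _ = _ := by ring

theorem exists_norm_integrandU_side_le :
    ∃ K, 0 < K ∧ ∀ t y τ : ℝ, 16 ≤ t → 0 ≤ τ → τ ≤ 2 → 1 ≤ |y| → |y| ≤ t / 2 →
      ‖integrandU t (y - I * τ)‖ ≤ K * t ^ 2 * Real.exp (-|y|) := by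
  obtain ⟨K, hK0, hK⟩ := exists_norm_exp_I_mul_theta_le
  refine ⟨2 * K * 48, by positivity, fun t y τ ht h0 h2 hy1 hyt => ?_⟩
  have hy := abs_le.1 hyt
  have hty : |t + y| = t + y := abs_of_nonneg (by linarith)
  have h1 := hK (t + y) τ (by rw [hty]; linarith) h0 h2
  push_cast at h1
  rw [add_sub_assoc] at h1
  rw [integrandU, norm_mul, norm_exp_sub_theta_ofReal]
  calc _ ≤ K * (|t + y| + 2) * (48 * t * Real.exp (-|y|)) := by
        gcongr
        exact norm_kernel_le ht h0 h2 hy1 hyt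
    _ ≤ K * (2 * t) * (48 * t * Real.exp (-|y|)) := by
        gcongr
        rw [hty]
        linarith
    _ = _ := by ring

theorem norm_sub_I_mul_le {y τ b : ℝ} (h0 : 0 ≤ τ) (h2 : τ ≤ 2) (hy : |y| ≤ b) :
    ‖(y - I * τ : ℂ)‖ ≤ b + 2 := by
  refine (norm_sub_le _ _).trans ?_
  rw [norm_mul, norm_I, one_mul, norm_real, norm_real, Real.norm_of_nonneg h0, Real.norm_eq_abs]
  linarith

theorem exists_norm_integrandTaylor_side_le :
    ∃ K, 0 < K ∧ ∀ t y τ : ℝ, 16 ≤ t → 0 ≤ τ → τ ≤ 2 → 1 ≤ |y| → |y| ≤ t / 2 →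
      (|y| + 2) ^ 2 ≤ t → ‖integrandTaylor t (y - I * τ)‖ ≤ K * t ^ 2 * Real.exp (-|y|) := by
  obtain ⟨K, hK0, hK⟩ := exists_norm_exp_taylor_le
  refine ⟨K * 48, by positivity, fun t y τ ht h0 h2 hy1 hyt hyt2 => ?_⟩
  have hx := norm_sub_I_mul_le h0 h2 (le_refl |y|)
  have h1 := hK t y τ ht h0 h2 (le_trans (by gcongr) hyt2)
  rw [integrandTaylor, norm_mul]
  calc _ ≤ K * t ^ (τ / 2) * (48 * t * Real.exp (-|y|)) := by
        gcongr
        exact norm_kernel_le ht h0 h2 hy1 hyt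
    _ ≤ K * t ^ (1 : ℝ) * (48 * t * Real.exp (-|y|)) := by
        gcongr
        · linarith
        · linarith
    _ = _ := by rw [Real.rpow_one]; ring

/-- With `Δ` the Taylor remainder of `ϑ`, the difference is `exp(P) (exp(iΔ) - 1)` times the kernel.
The condition `τ > 1/2` makes `ζ` bounded. The condition with `L` forces `‖Δ‖ ≤ 1`, so that
`‖exp(iΔ) - 1‖ ≤ 2‖Δ‖`. -/
theorem exists_norm_integrandU_sub_integrandTaylor_le {τ : ℝ} (h1 : 1 / 2 < τ) (h2 : τ < 2) :
    ∃ K L, 0 < K ∧ 0 < L ∧ ∀ t y b : ℝ, 16 ≤ t → |y| ≤ b → b + 2 ≤ t / 2 → (b + 2) ^ 2 ≤ t →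
      L * (b + 2) ^ 3 ≤ t ^ 2 →
      ‖integrandU t (y - I * τ) - integrandTaylor t (y - I * τ)‖ ≤
        K * (b + 2) ^ 3 * t ^ (τ / 2 - 2) := by
  obtain ⟨A, hA0, hA⟩ := exists_norm_theta_taylor_le
  obtain ⟨B, hB0, hB⟩ := exists_norm_exp_taylor_le
  obtain ⟨M, hM⟩ := exists_norm_riemannZeta_le (c := 1 / 2 + τ) (by linarith)
  obtain ⟨D, hD0, hD⟩ := exists_norm_pi_div_two_sinh_le (τ := τ) (by linarith) h2
  have hM0 : 0 ≤ M := (norm_nonneg _).trans (hM (1 / 2 + τ : ℝ) (by simp))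
  refine ⟨B * (2 * A) * ((M + 1) * D), A, by positivity, hA0,
    fun t y b ht hyb hbt hbt2 hL => ?_⟩
  have ht0 : 0 < t := by linarith
  set x : ℂ := y - I * τ with hx
  have hxb : ‖x‖ ≤ b + 2 := norm_sub_I_mul_le (by linarith) h2.le hyb
  have hcut := ofReal_mem_cutPlane t
  have hT := hA t x ht (hxb.trans hbt)
  have hE := hB t y τ ht (by linarith) h2.le (le_trans (by gcongr) hbt2)
  rw [← hx] at hE
  set P : ℂ := I * x * deriv theta t + I * (x ^ 2 / 2) * deriv (deriv theta) t with hP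
  set Δ : ℂ := theta (t + x) - theta t - x * thetaDensity t - x ^ 2 / 2 * deriv thetaDensity t
    with hΔ
  have hphase : I * theta (t + x) - I * theta t = P + I * Δ := by
    rw [hP, hΔ, deriv_theta hcut, deriv_deriv_theta hcut]
    ring
  have hΔb : ‖I * Δ‖ ≤ A * (b + 2) ^ 3 / t ^ 2 := by
    rw [norm_mul, norm_I, one_mul]
    exact hT.trans (by gcongr)
  have hΔ1 : ‖I * Δ‖ ≤ 1 := hΔb.trans ((div_le_one (by positivity)).2 hL)
  have hker : ‖kernel t x‖ ≤ (M + 1) * D := by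
    rw [kernel, norm_mul]
    have e1 := hM (1 / 2 + I * (t + x)) (by rw [hx, half_add_I_mul_re])
    have e2 : ‖(Real.pi / (2 * sinh (Real.pi * x / 2)) : ℂ)‖ ≤ D := by
      refine (hD y).trans (mul_le_of_le_one_right hD0.le ?_)
      rw [Real.exp_le_one_iff]
      linarith [abs_nonneg y]
    gcongr
    linarith
  have e : integrandU t x - integrandTaylor t x = exp P * (exp (I * Δ) - 1) * kernel t x := by
    rw [integrandU, integrandTaylor, hphase, exp_add]
    ring
  rw [e, norm_mul, norm_mul]
  calc ‖exp P‖ * ‖exp (I * Δ) - 1‖ * ‖kernel t x‖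
      ≤ B * t ^ (τ / 2) * (2 * (A * (b + 2) ^ 3 / t ^ 2)) * ((M + 1) * D) := by
        have hb0 : 0 ≤ b := (abs_nonneg y).trans hyb
        gcongr
        exact (norm_exp_sub_one_le hΔ1).trans (mul_le_mul_of_nonneg_left hΔb zero_le_two)
    _ = B * (2 * A) * ((M + 1) * D) * (b + 2) ^ 3 * (t ^ (τ / 2) / t ^ 2) := by ring
    _ = _ := by
        rw [Real.rpow_sub ht0, Real.rpow_two]

/-! ### Bookkeeping in `t` and assembly of the error terms. -/

theorem eventually_mul_log_add_pow_le (C A : ℝ) {n : ℕ} (hn : n ≠ 0) {r : ℝ} (hr : 0 < r) :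
    ∀ᶠ t : ℝ in atTop, A * (C * Real.log t + 2) ^ n ≤ t ^ r := by
  have hrn : 0 < r / n := by positivity
  have h1 : (fun t : ℝ => C * Real.log t + 2) =o[atTop] fun t : ℝ => t ^ (r / n) := by
    refine ((isLittleO_log_rpow_atTop hrn).const_mul_left C).add ?_
    exact Asymptotics.isLittleO_const_left.2
      (Or.inr (tendsto_norm_atTop_atTop.comp (tendsto_rpow_atTop hrn)))
  have h2 := ((h1.pow (Nat.pos_of_ne_zero hn)).const_mul_left A).bound one_pos
  filter_upwards [h2, eventually_gt_atTop 0] with t ht ht0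
  rw [one_mul, Real.norm_of_nonneg (r := (t ^ (r / n)) ^ n) (by positivity),
    ← Real.rpow_natCast (t ^ (r / n)),
    ← Real.rpow_mul ht0.le, div_mul_cancel₀ _ (by positivity)] at ht
  exact (le_abs_self _).trans ht

theorem exp_neg_mul_log_le {C t : ℝ} (hC : 10 ≤ C) (ht : 1 ≤ t) :
    Real.exp (-(C * Real.log t)) ≤ t ^ (-10 : ℝ) := by
  rw [Real.rpow_def_of_pos (by linarith)]
  refine Real.exp_le_exp.2 ?_
  nlinarith [Real.log_nonneg ht]

theorem sq_mul_rpow_neg_ten_le {t ε : ℝ} (ht : 1 ≤ t) (hε : 0 < ε) :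
    t ^ 2 * t ^ (-10 : ℝ) ≤ t ^ (-(7 / 4 : ℝ) + ε) := by
  rw [← Real.rpow_two, ← Real.rpow_add (by linarith)]
  exact Real.rpow_le_rpow_of_exponent_le ht (by linarith)

/-- The range of heights `t` in which the segment `[-b, b]` is long enough for the tails to be
negligible and short enough for the Taylor expansion to be accurate. -/
structure IsAdmissible (C ε L t : ℝ) : Prop where
  sixteen_le : 16 ≤ t
  one_le : 1 ≤ C * Real.log t
  add_two_le : C * Real.log t + 2 ≤ t / 2
  sq_le : (C * Real.log t + 2) ^ 2 ≤ t
  cube_le : L * (C * Real.log t + 2) ^ 3 ≤ t ^ 2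
  pow_four_le : (C * Real.log t + 2) ^ 4 ≤ t ^ (ε / 2)

theorem eventually_isAdmissible {C ε : ℝ} (hC : 0 < C) (hε : 0 < ε) (L : ℝ) :
    ∀ᶠ t in atTop, IsAdmissible C ε L t := by
  filter_upwards [eventually_ge_atTop 16,
    (Real.tendsto_log_atTop.const_mul_atTop hC).eventually_ge_atTop 1,
    eventually_mul_log_add_pow_le C 2 one_ne_zero one_pos,
    eventually_mul_log_add_pow_le C 1 two_ne_zero one_pos,
    eventually_mul_log_add_pow_le C L three_ne_zero two_pos,
    eventually_mul_log_add_pow_le C 1 four_ne_zero (half_pos hε)] with t h1 h2 h3 h4 h5 h6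
  rw [Real.rpow_one] at h3 h4
  rw [Real.rpow_two] at h5
  exact ⟨h1, h2, by linarith, by linarith, h5, by linarith⟩

theorem half_add_I_mul_ne_one {t : ℝ} {x : ℂ} (h : t + x.re ≠ 0) : 1 / 2 + I * (t + x) ≠ 1 := by
  intro h'
  have := congrArg im h'
  simp at this
  exact h this

theorem differentiableAt_integrandU_of_re {t : ℝ} {x : ℂ} (h1 : -2 < x.im) (h2 : x.im < 0)
    (h : t + x.re ≠ 0) : DifferentiableAt ℂ (integrandU t) x :=
  differentiableAt_integrandU h1 h2 (half_add_I_mul_ne_one h) (Or.inl (by simpa using h))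

theorem differentiableAt_integrandTaylor_of_re {t : ℝ} {x : ℂ} (h1 : -2 < x.im) (h2 : x.im < 0)
    (h : t + x.re ≠ 0) : DifferentiableAt ℂ (integrandTaylor t) x :=
  differentiableAt_integrandTaylor h1 h2 (half_add_I_mul_ne_one h)

theorem differentiableAt_sub_I_mul {f : ℂ → ℂ} {t b : ℝ} (hbt : b < t)
    (hf : ∀ x : ℂ, -2 < x.im → x.im < 0 → t + x.re ≠ 0 → DifferentiableAt ℂ f x)
    {y τ : ℝ} (h1 : 0 < τ) (h2 : τ < 2) (hy : -b ≤ y) : DifferentiableAt ℂ f (y - I * τ) := by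
  refine hf _ (by simpa using h2) (by simpa using h1) ?_
  simp only [sub_re, ofReal_re, mul_re, I_re, zero_mul, I_im, ofReal_im, mul_zero, sub_self,
    sub_zero]
  linarith

theorem intervalIntegrable_sub_I_mul {f : ℂ → ℂ} {t b τ : ℝ}
    (hf : ∀ x : ℂ, -2 < x.im → x.im < 0 → t + x.re ≠ 0 → DifferentiableAt ℂ f x)
    (h1 : 0 < τ) (h2 : τ < 2) (hb : 0 ≤ b) (hbt : b < t) :
    IntervalIntegrable (fun y : ℝ => f (y - I * τ)) volume (-b) b := by
  refine ContinuousOn.intervalIntegrable fun y hy => ContinuousAt.continuousWithinAt ?_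
  rw [uIcc_of_le (by linarith)] at hy
  exact ContinuousAt.comp (f := fun y : ℝ => (y : ℂ) - I * τ)
    (differentiableAt_sub_I_mul hbt hf h1 h2 hy.1).continuousAt (by fun_prop)

theorem norm_intervalIntegral_shift_le {f : ℂ → ℂ} {t C K ε τ₁ τ₂ : ℝ} (hε : 0 < ε)
    (hC : 10 ≤ C) (hK : 0 ≤ K) (h1 : 0 < τ₁) (h1' : τ₁ < 2) (h2 : 0 < τ₂) (h2' : τ₂ < 2)
    (ht : 1 ≤ t) (hbt : C * Real.log t < t)
    (hf : ∀ x : ℂ, -2 < x.im → x.im < 0 → t + x.re ≠ 0 → DifferentiableAt ℂ f x)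
    (hside : ∀ c τ : ℝ, |c| = C * Real.log t → 0 < τ → τ < 2 →
      ‖f (c - I * τ)‖ ≤ K * t ^ 2 * Real.exp (-|c|)) :
    ‖(∫ y in (-(C * Real.log t))..(C * Real.log t), f (y - I * τ₁)) -
        ∫ y in (-(C * Real.log t))..(C * Real.log t), f (y - I * τ₂)‖ ≤
      4 * K * t ^ (-(7 / 4 : ℝ) + ε) := by
  have hb0 : 0 ≤ C * Real.log t := mul_nonneg (by linarith) (Real.log_nonneg ht)
  have hτ : ∀ τ ∈ uIcc τ₁ τ₂, 0 < τ ∧ τ < 2 := fun τ hτ => by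
    rw [mem_uIcc] at hτ
    rcases hτ with h | h <;> constructor <;> linarith
  have hside' : ∀ c : ℝ, |c| = C * Real.log t → ∀ τ ∈ uIcc τ₁ τ₂, ‖f (c - I * τ)‖ ≤
      K * t ^ (-(7 / 4 : ℝ) + ε) := fun c hc τ hτ' => by
    refine (hside c τ hc (hτ τ hτ').1 (hτ τ hτ').2).trans ?_
    rw [mul_assoc, hc]
    refine mul_le_mul_of_nonneg_left ?_ hK
    refine le_trans ?_ (sq_mul_rpow_neg_ten_le ht hε)
    gcongr
    exact exp_neg_mul_log_le hC ht
  have hdiff : |τ₂ - τ₁| ≤ 2 := abs_le.2 ⟨by linarith, by linarith⟩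
  refine (norm_intervalIntegral_sub_le_of_rect (B := K * t ^ (-(7 / 4 : ℝ) + ε)) ?_
    (hside' _ (abs_of_nonneg hb0)) (hside' _ (by rw [abs_neg, abs_of_nonneg hb0]))).trans ?_
  · intro y hy τ hτ'
    rw [uIcc_of_le (by linarith)] at hy
    exact differentiableAt_sub_I_mul hbt hf (hτ τ hτ').1 (hτ τ hτ').2 hy.1
  · calc _ ≤ 2 * (K * t ^ (-(7 / 4 : ℝ) + ε) * 2) := by gcongr
      _ = _ := by ring

theorem exists_norm_integral_integrandU_shift_le {ε τ₁ τ₂ C : ℝ} (hε : 0 < ε) (hC : 10 ≤ C)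
    (h1 : 0 < τ₁) (h1' : τ₁ < 2) (h2 : 0 < τ₂) (h2' : τ₂ < 2) :
    ∃ K, ∀ L t : ℝ, IsAdmissible C ε L t →
      ‖(∫ y in (-(C * Real.log t))..(C * Real.log t), integrandU t (y - I * τ₁)) -
        ∫ y in (-(C * Real.log t))..(C * Real.log t), integrandU t (y - I * τ₂)‖ ≤
          K * t ^ (-(7 / 4 : ℝ) + ε) := by
  obtain ⟨K, hK0, hK⟩ := exists_norm_integrandU_side_le
  refine ⟨4 * K, fun L t ht => ?_⟩
  obtain ⟨h16, hb1, hb2, -, -, -⟩ := ht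
  exact norm_intervalIntegral_shift_le hε hC hK0.le h1 h1' h2 h2' (by linarith) (by linarith)
    (fun x hx1 hx2 => differentiableAt_integrandU_of_re hx1 hx2)
    fun c τ hc h0 h2 => hK t c τ h16 h0.le h2.le (by rwa [hc]) (by rw [hc]; linarith)

theorem exists_norm_integral_integrandTaylor_shift_le {ε τ₁ τ₂ C : ℝ} (hε : 0 < ε) (hC : 10 ≤ C)
    (h1 : 0 < τ₁) (h1' : τ₁ < 2) (h2 : 0 < τ₂) (h2' : τ₂ < 2) :
    ∃ K, ∀ L t : ℝ, IsAdmissible C ε L t →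
      ‖(∫ y in (-(C * Real.log t))..(C * Real.log t), integrandTaylor t (y - I * τ₁)) -
        ∫ y in (-(C * Real.log t))..(C * Real.log t), integrandTaylor t (y - I * τ₂)‖ ≤
          K * t ^ (-(7 / 4 : ℝ) + ε) := by
  obtain ⟨K, hK0, hK⟩ := exists_norm_integrandTaylor_side_le
  refine ⟨4 * K, fun L t ht => ?_⟩
  obtain ⟨h16, hb1, hb2, hb3, -, -⟩ := ht
  exact norm_intervalIntegral_shift_le hε hC hK0.le h1 h1' h2 h2' (by linarith) (by linarith)
    (fun x hx1 hx2 => differentiableAt_integrandTaylor_of_re hx1 hx2)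
    fun c τ hc h0 h2 => hK t c τ h16 h0.le h2.le (by rwa [hc]) (by rw [hc]; linarith) (by rwa [hc])

theorem exists_norm_integral_integrandU_sub_integrandTaylor_le {ε C : ℝ} (hε : 0 < ε)
    (hε1 : ε < 1) :
    ∃ K L, ∀ t : ℝ, IsAdmissible C ε L t →
      ‖(∫ y in (-(C * Real.log t))..(C * Real.log t),
          integrandU t (y - I * ((1 / 2 + ε : ℝ) : ℂ))) -
        ∫ y in (-(C * Real.log t))..(C * Real.log t),
          integrandTaylor t (y - I * ((1 / 2 + ε : ℝ) : ℂ))‖ ≤ K * t ^ (-(7 / 4 : ℝ) + ε) := by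
  obtain ⟨K, L, hK0, hL0, hK⟩ := exists_norm_integrandU_sub_integrandTaylor_le
    (τ := 1 / 2 + ε) (by linarith) (by linarith)
  refine ⟨K * 2, L, fun t ht => ?_⟩
  set b := C * Real.log t with hb
  obtain ⟨h16, hb1, hb2, hb3, hb4, hb5⟩ := ht
  have ht0 : 0 < t := by linarith
  rw [← intervalIntegral.integral_sub
    (intervalIntegrable_sub_I_mul (fun _ => differentiableAt_integrandU_of_re)
      (by linarith) (by linarith) (by linarith) (by linarith))
    (intervalIntegrable_sub_I_mul (fun _ => differentiableAt_integrandTaylor_of_re)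
      (by linarith) (by linarith) (by linarith) (by linarith))]
  refine (intervalIntegral.norm_integral_le_of_norm_le_const fun y hy => hK t y b h16
    (by
      rw [uIoc_of_le (by linarith)] at hy
      exact abs_le.2 ⟨hy.1.le, hy.2⟩) hb2 hb3 hb4).trans ?_
  rw [sub_neg_eq_add, abs_of_nonneg (by linarith)]
  -- At `τ = 1/2 + ε` the saving is `t^(-7/4 + ε/2)`. The other `t^(ε/2)` pays for `(b+2)⁴`: three
  -- powers from the Taylor remainder, one from the length of the segment.
  have hexp : t ^ ((1 / 2 + ε) / 2 - 2) * t ^ (ε / 2) = t ^ (-(7 / 4 : ℝ) + ε) := by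
    rw [← Real.rpow_add ht0]
    congr 1
    ring
  rw [← hexp]
  have hpos : 0 < t ^ ((1 / 2 + ε) / 2 - 2) := by positivity
  calc K * (b + 2) ^ 3 * t ^ ((1 / 2 + ε) / 2 - 2) * (b + b)
      ≤ K * (b + 2) ^ 3 * t ^ ((1 / 2 + ε) / 2 - 2) * (2 * (b + 2)) := by
        gcongr
        linarith
    _ = K * 2 * (t ^ ((1 / 2 + ε) / 2 - 2) * (b + 2) ^ 4) := by ring
    _ ≤ _ := by gcongr

end RiemannSiegel

theorem theoremT (ε σ₀ : ℝ) (hε₀ : 0 < ε) (hε₁ : ε < 1) (hσ₀ : 0 < σ₀) (hσ₂ : σ₀ < 2) :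
    (∀ σ : ℝ, 0 < σ → σ < 1 / 2 → ∀ t : ℝ,
      MeasureTheory.Integrable fun y : ℝ =>
        RiemannSiegel.integrandU t (y - Complex.I * σ)) ∧
    ∃ C₀ : ℝ, 0 < C₀ ∧ ∀ C : ℝ, C₀ ≤ C → ∀ σ : ℝ, 0 < σ → σ < 1 / 2 →
      (fun t : ℝ => RiemannSiegel.U σ t - RiemannSiegel.taylorApprox σ₀ (C * Real.log t) t)
        =O[Filter.atTop] fun t : ℝ => t ^ (-(7 / 4 : ℝ) + ε) := by
  -- The choice `C₀ = 10` serves every `ε` and `σ₀`: tails and sides are `O(t² t^(-10))`, well below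
  -- `t^(-7/4)`.
  refine ⟨fun σ h0 h1 t => RiemannSiegel.integrable_integrandU h0 h1 t, 10, by norm_num,
    fun C hC σ h0 h1 => ?_⟩
  obtain ⟨K₁, hK₁0, hK₁⟩ :=
    RiemannSiegel.exists_norm_integral_sub_intervalIntegral_integrandU_le h0 h1
  obtain ⟨K₂, hK₂⟩ := RiemannSiegel.exists_norm_integral_integrandU_shift_le
    (τ₁ := σ) (τ₂ := 1 / 2 + ε) hε₀ hC h0 (by linarith) (by linarith) (by linarith)
  obtain ⟨K₃, L, hK₃⟩ :=
    RiemannSiegel.exists_norm_integral_integrandU_sub_integrandTaylor_le (C := C) hε₀ hε₁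
  obtain ⟨K₄, hK₄⟩ := RiemannSiegel.exists_norm_integral_integrandTaylor_shift_le
    (τ₁ := 1 / 2 + ε) (τ₂ := σ₀) hε₀ hC (by linarith) (by linarith) hσ₀ hσ₂
  refine Asymptotics.IsBigO.of_bound (K₁ * 4 + K₂ + K₃ + K₄) ?_
  filter_upwards [RiemannSiegel.eventually_isAdmissible (C := C) (by linarith) hε₀ L] with t ht
  have h16 := ht.sixteen_le
  have ht0 : 0 < t := by linarith
  have e1 := hK₁ t (C * Real.log t) (by linarith [ht.one_le])
  have e2 := hK₂ L t ht
  have e3 := hK₃ t ht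
  have e4 := hK₄ L t ht
  have e1' : K₁ * (|t| + 3) ^ 2 * Real.exp (-(C * Real.log t)) ≤
      K₁ * 4 * t ^ (-(7 / 4 : ℝ) + ε) := by
    rw [abs_of_pos ht0]
    calc K₁ * (t + 3) ^ 2 * Real.exp (-(C * Real.log t))
        ≤ K₁ * (2 * t) ^ 2 * t ^ (-10 : ℝ) := by
          gcongr
          · linarith
          · exact RiemannSiegel.exp_neg_mul_log_le hC (by linarith)
      _ = K₁ * 4 * (t ^ 2 * t ^ (-10 : ℝ)) := by ring
      _ ≤ _ := by
          gcongr
          exact RiemannSiegel.sq_mul_rpow_neg_ten_le (by linarith) hε₀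
  have hpre : ‖(1 / (2 * Real.pi * Complex.I) : ℂ)‖ ≤ 1 := by
    rw [norm_div, norm_mul, norm_mul, Complex.norm_I, norm_one, Complex.norm_real,
      Real.norm_of_nonneg Real.pi_pos.le, show ‖(2 : ℂ)‖ = 2 by simp, mul_one]
    exact (div_le_one (by positivity)).2 (by linarith [Real.pi_gt_three])
  rw [RiemannSiegel.U, RiemannSiegel.taylorApprox, ← mul_sub, norm_mul,
    Real.norm_of_nonneg (by positivity)]
  refine (mul_le_of_le_one_left (norm_nonneg _) hpre).trans ?_
  -- The chain: truncate on `Im x = -σ`, shift to `-(1/2 + ε)`, pass to the Taylor phase there,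
  -- shift to `-σ₀`.
  refine (norm_sub_le_norm_sub_add_norm_sub _ _ _).trans ((add_le_add (e1.trans e1')
    ((norm_sub_le_norm_sub_add_norm_sub _ _ _).trans (add_le_add e2
      ((norm_sub_le_norm_sub_add_norm_sub _ _ _).trans (add_le_add e3 e4))))).trans
      (le_of_eq (by ring)))
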